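/- Let $\beta>0$ and $c\ge 0$. For $t\in\mathbb R$ let $Q_c(t)=t^2+2c\log\frac1{|t|}$, with values in $]-\infty,+\infty]$ (so $Q_c(0)=+\infty$ if $c>0$, and $Q_0(t)=t^2$). For a probability measure $\mu$ on $\mathbb R$ let $$E_{\beta,c}(\mu)=\frac{\beta}{2}\int_{\mathbb R^2}\log\frac1{|s-t|}\,\mu(ds)\,\mu(dt)+\int_{\mathbb R}Q_c(t)\,\mu(dt)\in\,]-\infty,+\infty],$$ where $E_{\beta,c}(\mu)=+\infty$ if $\int Q_c\,d\mu=+\infty$. Put $$a=\sqrt{\tfrac{\beta}{2}}\sqrt{1+\tfrac{2c}{\beta}-\sqrt{1+\tfrac{4c}{\beta}}},\qquad b=\sqrt{\tfrac{\beta}{2}}\sqrt{1+\tfrac{2c}{\beta}+\sqrt{1+\tfrac{4c}{\beta}}},\qquad S=[-b,-a]\cup[a,b],$$ and let $\nu_{\beta,c}$ be the measure on $\mathbb R$ whose density with respect to Lebesgue measure is $f_{\beta,c}(t)=\frac{2}{\pi\beta}\frac1{|t|}\sqrt{(t^2-a^2)(b^2-t^2)}$ for $t\in S$ and $0$ for $t\notin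 S$. Let $U_{\beta,c}(x)=\int_{\mathbb R}\log\frac1{|x-y|}\,\nu_{\beta,c}(dy)$ and $$E^*_{\beta,c}=\frac{3\beta}{8}+\frac{\beta}{4}\log\frac4\beta+c\Big(\frac32+\log\frac4\beta\Big)+\frac{2c^2}{\beta}\log\frac{4c}{\beta}-\Big(\frac{2c^2}{\beta}+c+\frac\beta8\Big)\log\Big(1+\frac{4c}{\beta}\Big),$$ with $\frac{2c^2}{\beta}\log\frac{4c}{\beta}=0$ for $c=0$. **Proposition 4.2.** $\nu_{\beta,c}$ is a probability measure and it is the equilibrium measure: it is the unique probability measure on $\mathbb R$ that minimizes $E_{\beta,c}$, and $$\inf\{E_{\beta,c}(\mu)\mid \mu \text{ a probability measure on }\mathbb R\}=E_{\beta,c}(\nu_{\beta,c})=E^*_{\beta,c}.$$ Furthermore there is a constant $C\in\mathbb R$ such that (i) $U_{\beta,c}(x)+\frac1\beta Q_c(x)=C$ for all $x\in S$; (ii) $U_{\beta,c}(x)+\frac1\beta Q_c(x)\ge C$ for all $x\in\mathbb R\setminus S$. -/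

import Mathlib

open MeasureTheory

namespace LogGas

noncomputable section

/-- The extended integral `∫ f⁺ dμ - ∫ f⁻ dμ` of an extended-real valued function. It has its usual
meaning whenever one of the two terms is finite (this is the case for every use below that
matters, see `energy`). -/
def eintegral {α : Type*} [MeasurableSpace α] (μ : Measure α) (f : α → EReal) : EReal :=
  ((∫⁻ x, (f x).toENNReal ∂μ : ENNReal) : EReal) - ((∫⁻ x, (-f x).toENNReal ∂μ : ENNReal) : EReal)

/-- `log (1 / |x|)` with values in `]-∞, +∞]`; the value at `0` is `+∞`. -/
def logInv (x : ℝ) : EReal :=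
  if x = 0 then ⊤ else ((Real.log (1 / |x|) : ℝ) : EReal)

/-- The potential `Q_c(t) = t² + 2 c log (1 / |t|)` with values in `]-∞, +∞]`.
For `c > 0` one has `Q_c(0) = +∞`; for `c = 0` one has `Q_0(t) = t²` (as `0 * ⊤ = 0` in `EReal`). -/
def Q (c t : ℝ) : EReal :=
  ((t ^ 2 : ℝ) : EReal) + ((2 * c : ℝ) : EReal) * logInv t

/-- The logarithmic potential `U^μ(x) = ∫ log (1 / |x - y|) μ(dy)`. -/
def logPotential (μ : Measure ℝ) (x : ℝ) : EReal :=
  eintegral μ fun y => logInv (x - y)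

/-- The logarithmic energy `∬ log (1 / |s - t|) μ(ds) μ(dt)`. -/
def logEnergy (μ : Measure ℝ) : EReal :=
  eintegral (μ.prod μ) fun p => logInv (p.1 - p.2)

/-- The energy `E_{β,c}(μ) = (β/2) ∬ log (1 / |s - t|) μ(ds) μ(dt) + ∫ Q_c dμ`, in `]-∞, +∞]`.
As `Q_c` is bounded below (`c ≥ 0`), `∫ Q_c dμ` always makes sense in `]-∞, +∞]`. If it is finite
then `μ` has a finite second moment and the double integral makes sense in `]-∞, +∞]`. If it is
`+∞` the energy is `+∞`; this convention only concerns measures for which the double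
integral is `-∞` or has the form `∞ - ∞`, and it is what the integral of the kernel
`(β/2) log (1 / |s - t|) + Q_c(s) / 2 + Q_c(t) / 2`, which is bounded below, gives. -/
def energy (β c : ℝ) (μ : Measure ℝ) : EReal :=
  open Classical in
  if eintegral μ (Q c) = ⊤ then ⊤
  else ((β / 2 : ℝ) : EReal) * logEnergy μ + eintegral μ (Q c)

/-- The inner end point `a` of the support. -/
def a (β c : ℝ) : ℝ := √(β / 2) * √(1 + 2 * c / β - √(1 + 4 * c / β))

/-- The outer end point `b` of the support. -/
def b (β c : ℝ) : ℝ := √(β / 2) * √(1 + 2 * c / β + √(1 + 4 * c / β))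

/-- The set `S = [-b, -a] ∪ [a, b]`. -/
def S (β c : ℝ) : Set ℝ := Set.Icc (-b β c) (-a β c) ∪ Set.Icc (a β c) (b β c)

/-- The density `f_{β,c}`. For `c = 0` one has `a = 0`; the value at the single point
`t = 0` is then irrelevant. -/
def density (β c : ℝ) : ℝ → ℝ :=
  (S β c).indicator fun t =>
    2 / (Real.pi * β) * (1 / |t|) * √((t ^ 2 - a β c ^ 2) * (b β c ^ 2 - t ^ 2))

/-- The measure `ν_{β,c}`, with density `f_{β,c}` with respect to the Lebesgue measure. -/
def nu (β c : ℝ) : Measure ℝ :=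
  volume.withDensity fun t => ENNReal.ofReal (density β c t)

/-- The value `E*_{β,c}`. For `c = 0` the term `(2c²/β) log (4c/β)` is `0`. -/
def Estar (β c : ℝ) : ℝ :=
  3 * β / 8 + β / 4 * Real.log (4 / β) + c * (3 / 2 + Real.log (4 / β))
    + 2 * c ^ 2 / β * Real.log (4 * c / β)
    - (2 * c ^ 2 / β + c + β / 8) * Real.log (1 + 4 * c / β)

end

end LogGas

/-!
Write `β = 4 q²` and `c = p² - q²` with `0 < q ≤ p`; then `a = p - q` and `b = p + q`. The measure
`ν = ν_{β,c}` is even, and the substitution `|t| = ‖p + q e^{iθ}‖` turns `∫ g(t²) ν(dt)` into the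
average over the unit circle of `g(‖p + q z‖²)` against the weight
`2 (Im z)² / ‖1 + ρ z‖²`, where `ρ = q / p` (`integral_density`). This weight is a linear
combination of `1`, `Re z` and the Poisson kernel of the point `-ρ`, so it integrates harmonic
functions in closed form: total mass, second moment and logarithmic potential of `ν` come out of the
mean value property and of Poisson's formula. For the potential at `x`, write
`x² = (p + q w) (p + q / w)` with `‖w‖ ≥ 1`; then
`|x² - ‖p + q z‖²| = p q ‖z - w‖ ‖z - conj w‖ / ‖w‖`, and `z ↦ log ‖z - w‖` is harmonic in the disc
(`integral_log_sub_nu`).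

The points of the support are those with `‖w‖ = 1`, and there the resulting formula is the
Euler-Lagrange equation `U + Q / β = C` (`eulerLagrange_eq`). Off the support `w` is real; the
excess `U + Q / β - C` vanishes at `|w| = 1` and is nondecreasing in `|w|`
(`eulerLagrange_excess_nonneg`).

The minimizing property follows from the Euler-Lagrange conditions and the positive definiteness of
the logarithmic energy (`logEnergy_sub`): with `I` the logarithmic energy,
`E(μ) - E(ν) ≥ (β / 2) I(μ - ν) ≥ 0`. For the latter, Frullani's integral
`2 log (1 / |x|) = ∫₀^∞ (exp (-t x²) - exp (-t)) / t dt` makes `I(μ - ν)` a mixture of Gaussian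
interactions, each of which is the squared `L²` norm of the difference of the characteristic
functions with respect to a Gaussian measure. It vanishes only if the characteristic functions
agree. The value of the energy is `β C / 2 + (1 / 2) ∫ Q dν`, and `∫ Q dν` is known from the second
moment and from the potential at `0`.
-/

/-! ### Averages over the unit circle -/

namespace LogGas

open Complex Metric Set Real Filter Topology

/-- On the unit circle `Re z = (z + z⁻¹) / 2`, so averaging a holomorphic function against `Re z`
extracts half of its first Taylor coefficient. -/
theorem circleAverage_re_smul {F : ℂ → ℂ} {U : Set ℂ} (hU : IsOpen U) (hUF : closedBall 0 1 ⊆ U)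
    (hF : DifferentiableOn ℂ F U) :
    circleAverage (fun z => z.re • F z) 0 1 = deriv F 0 / 2 := by
  have hcont : ContinuousOn F (sphere 0 |1|) :=
    hF.continuousOn.mono fun z hz => hUF (sphere_subset_closedBall (by simpa using hz))
  have h1 : circleAverage (fun z => z * F z) 0 1 = 0 := by
    have hd : DiffContOnCl ℂ (fun z => z * F z) (ball 0 |1|) := by
      refine DifferentiableOn.diffContOnCl (DifferentiableOn.mul differentiableOn_id (hF.mono ?_))
      exact (closure_ball_subset_closedBall.trans (by simpa using hUF))
    simpa using hd.circleAverage
  have h2 : circleAverage (fun z => z⁻¹ * F z) 0 1 = deriv F 0 := by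
    rw [circleAverage_eq_circleIntegral one_ne_zero,
      ← two_pi_I_inv_smul_circleIntegral_sub_sq_inv_smul_of_differentiable hU hUF hF
        (mem_ball_self one_pos)]
    congr 2
    funext z
    simp only [sub_zero, smul_eq_mul]
    ring
  have hz0 : ∀ z ∈ sphere (0 : ℂ) |1|, z ≠ 0 := by
    intro z hz h
    simp [h] at hz
  have i1 : CircleIntegrable (fun z => z * F z) 0 1 :=
    ContinuousOn.circleIntegrable' (continuousOn_id.mul hcont)
  have i2 : CircleIntegrable (fun z => z⁻¹ * F z) 0 1 :=
    ContinuousOn.circleIntegrable' ((continuousOn_inv₀.mono hz0).mul hcont)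
  have h3 : circleAverage (fun z => z.re • F z) 0 1
      = circleAverage (fun z => (1 / 2 : ℂ) • (z * F z + z⁻¹ * F z)) 0 1 := by
    refine circleAverage_congr_sphere fun z hz => ?_
    have hz' : ‖z‖ = 1 := by simpa using hz
    have : ((z.re : ℝ) : ℂ) = (z + z⁻¹) / 2 := by
      rw [Complex.inv_eq_conj hz', Complex.add_conj]
      push_cast
      ring
    simp only [real_smul, smul_eq_mul, this]
    ring
  rw [h3, circleAverage_fun_smul, circleAverage_fun_add i1 i2, h1, h2, smul_eq_mul]
  ring

theorem circleAverage_re : circleAverage (fun z : ℂ => z.re) 0 1 = 0 := by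
  have h := circleAverage_re_smul (F := fun _ => (1 : ℂ)) isOpen_univ (subset_univ _)
    (differentiableOn_const _)
  have hi : CircleIntegrable (fun z : ℂ => z.re • (1 : ℂ)) 0 1 :=
    ContinuousOn.circleIntegrable' (by fun_prop)
  have := reCLM.circleAverage_comp_comm hi
  rw [h] at this
  simpa [Function.comp_def] using this

theorem circleAverage_re_mul_re : circleAverage (fun z : ℂ => z.re * z.re) 0 1 = 1 / 2 := by
  have h := circleAverage_re_smul (F := fun z => z) isOpen_univ (subset_univ _)
    differentiableOn_id
  have hi : CircleIntegrable (fun z : ℂ => z.re • z) 0 1 :=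
    ContinuousOn.circleIntegrable' (by fun_prop)
  have := reCLM.circleAverage_comp_comm hi
  rw [h] at this
  simpa [Function.comp_def] using this

theorem circleIntegrable_mul {k f : ℂ → ℝ} (hk : ContinuousOn k (sphere 0 1))
    (hf : CircleIntegrable f 0 1) : CircleIntegrable (fun z => k z * f z) 0 1 := by
  refine IntervalIntegrable.continuousOn_mul hf ?_
  exact hk.comp (continuous_circleMap 0 1).continuousOn fun t _ =>
    circleMap_mem_sphere 0 zero_le_one t

theorem circleIntegrable_mul_log_norm_sub {k : ℂ → ℝ} (hk : ContinuousOn k (sphere 0 1)) (w : ℂ) :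
    CircleIntegrable (fun z => k z * Real.log ‖z - w‖) 0 1 :=
  circleIntegrable_mul hk (circleIntegrable_log_norm_sub_const 1)

/-- A branch of `log (z - w)` on a neighbourhood of the closed unit disc, up to an imaginary
constant, for `w` outside the disc. -/
theorem exists_holomorphic_log {w : ℂ} (hw : 1 < ‖w‖) :
    ∃ F : ℂ → ℂ, DifferentiableOn ℂ F (ball 0 ‖w‖) ∧ deriv F 0 = -w⁻¹ ∧
      ∀ z ∈ ball (0 : ℂ) ‖w‖, (F z).re = Real.log ‖z - w‖ := by
  have hw0 : w ≠ 0 := by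
    rintro rfl
    simp at hw
    linarith
  have hs : ∀ z ∈ ball (0 : ℂ) ‖w‖, 1 - z / w ∈ slitPlane := by
    intro z hz
    left
    have h1 : ‖z / w‖ < 1 := by
      rw [norm_div, div_lt_one (norm_pos_iff.2 hw0)]
      simpa using hz
    have := (abs_le.1 (abs_re_le_norm (z / w))).2
    simp only [sub_re, one_re]
    linarith
  have hd : ∀ z ∈ ball (0 : ℂ) ‖w‖, HasDerivAt
      (fun z => ((Real.log ‖w‖ : ℝ) : ℂ) + Complex.log (1 - z / w))
      ((-(1 / w)) / (1 - z / w)) z := by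
    intro z hz
    exact ((((hasDerivAt_id z).div_const w).const_sub 1).clog (hs z hz)).const_add _
  refine ⟨_, fun z hz => (hd z hz).differentiableAt.differentiableWithinAt, ?_, ?_⟩
  · rw [(hd 0 (by simpa using hw0)).deriv]
    simp
  · intro z hz
    have h0 := slitPlane_ne_zero (hs z hz)
    have h1 : 1 - z / w = (w - z) / w := by field_simp
    rw [add_re, ofReal_re, Complex.log_re, h1, norm_div, Real.log_div, norm_sub_rev]
    · ring
    · rw [h1] at h0
      exact fun h => h0 (by rw [norm_eq_zero.1 h, zero_div])
    · exact norm_ne_zero_iff.2 hw0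

/-- For `‖w‖ = ‖z‖ = 1` the distance from `z` to `r w` is at least the distance from `z` to `w`
as soon as `r ≥ 1`. -/
theorem norm_sub_le_norm_sub_mul {w z : ℂ} (hw : ‖w‖ = 1) (hz : ‖z‖ = 1) {r : ℝ} (hr : 1 ≤ r) :
    ‖z - w‖ ≤ ‖z - r * w‖ := by
  have h1 : w.re ^ 2 + w.im ^ 2 = 1 := by
    rw [← Complex.sq_norm_sub_sq_re w, hw]; ring
  have h2 : z.re ^ 2 + z.im ^ 2 = 1 := by
    rw [← Complex.sq_norm_sub_sq_re z, hz]; ring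
  rw [← sq_le_sq₀ (norm_nonneg _) (norm_nonneg _), Complex.sq_norm, Complex.sq_norm,
    normSq_apply, normSq_apply]
  simp only [sub_re, sub_im, mul_re, mul_im, ofReal_re, ofReal_im]
  have h3 : z.re * w.re + z.im * w.im ≤ 1 := by
    nlinarith [sq_nonneg (z.re - w.re), sq_nonneg (z.im - w.im)]
  nlinarith [mul_nonneg (sub_nonneg.2 hr) (sub_nonneg.2 h3),
    mul_nonneg (sub_nonneg.2 hr) (sub_nonneg.2 hr)]

/-- Half of the first Fourier coefficient of `log ‖z - w‖`, for `w` outside the open disc. When `w`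
lies on the circle the formula is the limit of the formula for `r w`, as `r` decreases to `1`. -/
theorem circleAverage_re_mul_log_norm_sub {w : ℂ} (hw : 1 ≤ ‖w‖) :
    circleAverage (fun z => z.re * Real.log ‖z - w‖) 0 1 = -(w⁻¹).re / 2 := by
  have key : ∀ w : ℂ, 1 < ‖w‖ →
      circleAverage (fun z => z.re * Real.log ‖z - w‖) 0 1 = -(w⁻¹).re / 2 := by
    intro w hw
    obtain ⟨F, hF, hF', hFre⟩ := exists_holomorphic_log hw
    have hsub : closedBall (0 : ℂ) 1 ⊆ ball 0 ‖w‖ := closedBall_subset_ball hw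
    have h := circleAverage_re_smul isOpen_ball hsub hF
    have hi : CircleIntegrable (fun z : ℂ => z.re • F z) 0 1 := by
      refine ContinuousOn.circleIntegrable' (ContinuousOn.smul (f := re) (by fun_prop) ?_)
      exact hF.continuousOn.mono fun z hz => hsub (sphere_subset_closedBall (by simpa using hz))
    have h2 := reCLM.circleAverage_comp_comm hi
    rw [h, hF'] at h2
    calc _ = circleAverage (⇑reCLM ∘ fun z => z.re • F z) 0 1 := by
            refine circleAverage_congr_sphere fun z hz => ?_
            have := hFre z (hsub (sphere_subset_closedBall (by simpa using hz)))
            simp [this]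
      _ = _ := by rw [h2]; simp
  rcases hw.lt_or_eq with hw | hw
  · exact key w hw
  have hw0 : w ≠ 0 := by
    rintro rfl
    simp at hw
  have hT : Tendsto (fun r : ℝ => circleAverage (fun z => z.re * Real.log ‖z - r * w‖) 0 1)
      (𝓝[>] 1) (𝓝 (circleAverage (fun z => z.re * Real.log ‖z - w‖) 0 1)) := by
    refine Tendsto.smul tendsto_const_nhds ?_
    have hev : ∀ᶠ r : ℝ in 𝓝[>] 1, r ∈ Ioo (1 : ℝ) 2 :=
      Ioo_mem_nhdsGT (by norm_num)
    have hne : ∀ᵐ t : ℝ, circleMap 0 1 t ≠ w :=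
      measure_eq_zero_iff_ae_notMem.1
        (((countable_singleton w).preimage_circleMap 0 one_ne_zero).measure_zero volume)
    refine intervalIntegral.tendsto_integral_filter_of_dominated_convergence
      (fun t => |Real.log ‖circleMap 0 1 t - w‖| + Real.log 3) ?_ ?_ ?_ ?_
    · filter_upwards with r
      have := circleIntegrable_mul_log_norm_sub (k := fun z => z.re) (by fun_prop) (r * w)
      rw [CircleIntegrable, intervalIntegrable_iff] at this
      exact this.aestronglyMeasurable
    · filter_upwards [hev] with r hr
      filter_upwards [hne] with t ht _
      set z := circleMap 0 1 t with hzdef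
      have hz : ‖z‖ = 1 := by simp [hzdef]
      have hpos : 0 < ‖z - w‖ := norm_pos_iff.2 (sub_ne_zero.2 ht)
      have hle := norm_sub_le_norm_sub_mul hw.symm hz hr.1.le
      have hup : ‖z - r * w‖ ≤ 3 := by
        refine (norm_sub_le _ _).trans ?_
        rw [norm_mul, hz, ← hw, norm_real, Real.norm_eq_abs, abs_of_pos (by linarith [hr.1])]
        linarith [hr.2]
      have h1 := Real.log_le_log hpos hle
      have h2 := Real.log_le_log (hpos.trans_le hle) hup
      have h3 : |z.re| ≤ 1 := hz ▸ abs_re_le_norm z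
      have h4 := neg_abs_le (Real.log ‖z - w‖)
      have h5 : 0 ≤ Real.log 3 := Real.log_nonneg (by norm_num)
      rw [norm_mul, Real.norm_eq_abs, Real.norm_eq_abs]
      calc |z.re| * |Real.log ‖z - r * w‖| ≤ 1 * |Real.log ‖z - r * w‖| := by gcongr
        _ ≤ _ := by
          rw [one_mul, abs_le]
          constructor <;> linarith [abs_nonneg (Real.log ‖z - w‖)]
    · exact IntervalIntegrable.add
        (circleIntegrable_log_norm_sub_const (a := w) (c := 0) 1).abs (by simp)
    · filter_upwards [hne] with t ht _
      have hc : ContinuousAt (fun r : ℝ => (circleMap 0 1 t).re *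
          Real.log ‖circleMap 0 1 t - r * w‖) 1 := by
        refine ContinuousAt.mul continuousAt_const (ContinuousAt.log (by fun_prop) ?_)
        simpa [sub_eq_zero] using ht
      have := hc.tendsto.mono_left (nhdsWithin_le_nhds (s := Ioi 1))
      simpa using this
  have hT2 : Tendsto (fun r : ℝ => -((r * w : ℂ)⁻¹).re / 2) (𝓝[>] 1) (𝓝 (-(w⁻¹).re / 2)) := by
    have hc : ContinuousAt (fun r : ℝ => -((r * w : ℂ)⁻¹).re / 2) 1 := by
      have : ContinuousAt (fun r : ℝ => (r * w : ℂ)⁻¹) 1 :=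
        ContinuousAt.inv₀ (by fun_prop) (by simpa using hw0)
      exact ((Complex.continuous_re.continuousAt.comp this).neg).div_const 2
    have := hc.tendsto.mono_left (nhdsWithin_le_nhds (s := Ioi 1))
    simpa using this
  refine tendsto_nhds_unique (hT.congr' ?_) hT2
  filter_upwards [self_mem_nhdsWithin] with r hr
  refine key _ ?_
  have hr : 1 < r := hr
  rw [norm_mul, ← hw, norm_real, Real.norm_eq_abs, abs_of_pos (by linarith), mul_one]
  exact hr

theorem continuousOn_poissonKernel {v : ℂ} (hv : ‖v‖ < 1) :
    ContinuousOn (poissonKernel 0 v) (sphere 0 1) := by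
  unfold poissonKernel
  refine ContinuousOn.div (by fun_prop) (by fun_prop) fun z hz => ?_
  have : z - v ≠ 0 := by
    intro h
    rw [sub_eq_zero.1 h] at hz
    simp at hz
    linarith
  simpa using this

theorem circleAverage_poissonKernel_mul_log_norm_sub {v w : ℂ} (hv : ‖v‖ < 1) (hw : 1 ≤ ‖w‖) :
    circleAverage (fun z => poissonKernel 0 v z * Real.log ‖z - w‖) 0 1 = Real.log ‖v - w‖ := by
  rcases hw.lt_or_eq with hw | hw
  · obtain ⟨F, hF, -, hFre⟩ := exists_holomorphic_log hw
    have hsub : closedBall (0 : ℂ) 1 ⊆ ball 0 ‖w‖ := closedBall_subset_ball hw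
    have hd : DiffContOnCl ℂ F (ball 0 1) :=
      (hF.mono (closure_ball_subset_closedBall.trans hsub)).diffContOnCl
    have hv' : v ∈ ball (0 : ℂ) 1 := by simpa using hv
    have h := hd.circleAverage_poissonKernel_smul hv'
    have hi : CircleIntegrable (poissonKernel 0 v • F) 0 1 := by
      refine ContinuousOn.circleIntegrable zero_le_one
        (ContinuousOn.smul (continuousOn_poissonKernel hv) ?_)
      exact hF.continuousOn.mono fun z hz => hsub (sphere_subset_closedBall hz)
    have h2 := reCLM.circleAverage_comp_comm hi
    rw [h] at h2
    calc _ = circleAverage (⇑reCLM ∘ (poissonKernel 0 v • F)) 0 1 := by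
            refine circleAverage_congr_sphere fun z hz => ?_
            have := hFre z (hsub (sphere_subset_closedBall (by simpa using hz)))
            simp [this]
      _ = _ := by
        rw [h2]
        exact hFre v (hsub (ball_subset_closedBall hv'))
  · have h := circleAverage_re_herglotzRieszKernel_mul_log (w := v) (ρ := w) (c := 0) (R := 1)
      (by simp [hw]) (by simpa using hv)
    rw [← poissonKernel_eq_re_herglotzRieszKernel] at h
    exact h

theorem circleAverage_poissonKernel {v : ℂ} (hv : ‖v‖ < 1) :
    circleAverage (poissonKernel 0 v) 0 1 = 1 := by
  have h := (diffContOnCl_const (c := (1 : ℂ)) (s := ball 0 1) (𝕜 := ℂ))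
    |>.circleAverage_poissonKernel_smul (w := v) (by simpa using hv)
  have hi : CircleIntegrable (poissonKernel 0 v • fun _ => (1 : ℂ)) 0 1 :=
    ContinuousOn.circleIntegrable zero_le_one
      (ContinuousOn.smul (continuousOn_poissonKernel hv) continuousOn_const)
  have h2 := reCLM.circleAverage_comp_comm hi
  rw [h] at h2
  simpa [Function.comp_def] using h2

theorem circleAverage_poissonKernel_mul_re {v : ℂ} (hv : ‖v‖ < 1) :
    circleAverage (fun z => poissonKernel 0 v z * z.re) 0 1 = v.re := by
  have h := (DifferentiableOn.diffContOnCl (𝕜 := ℂ) (s := ball 0 1)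
    differentiableOn_id).circleAverage_poissonKernel_smul (w := v) (by simpa using hv)
  have hi : CircleIntegrable (poissonKernel 0 v • (id : ℂ → ℂ)) 0 1 :=
    ContinuousOn.circleIntegrable zero_le_one
      (ContinuousOn.smul (continuousOn_poissonKernel hv) continuousOn_id)
  have h2 := reCLM.circleAverage_comp_comm hi
  rw [h] at h2
  simpa [Function.comp_def] using h2

end LogGas

/-! ### Positive definiteness of the logarithmic energy -/

namespace LogGas

open Real Set Filter Topology ProbabilityTheory Complex ComplexConjugate

theorem abs_exp_sub_exp_le {x y m : ℝ} (hx : m ≤ x) (hy : m ≤ y) :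
    |Real.exp (-x) - Real.exp (-y)| ≤ |x - y| * Real.exp (-m) := by
  wlog h : x ≤ y generalizing x y
  · rw [abs_sub_comm, abs_sub_comm x]
    exact this hy hx (le_of_not_ge h)
  have h1 : Real.exp (-y) = Real.exp (-x) * Real.exp (-(y - x)) := by rw [← Real.exp_add]; ring_nf
  have h2 : 1 - (y - x) ≤ Real.exp (-(y - x)) := by linarith [Real.add_one_le_exp (-(y - x))]
  have h3 : Real.exp (-x) ≤ Real.exp (-m) := Real.exp_le_exp.2 (by linarith)
  have h4 : Real.exp (-y) ≤ Real.exp (-x) := Real.exp_le_exp.2 (by linarith)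
  rw [abs_of_nonneg (by linarith), abs_sub_comm, abs_of_nonneg (by linarith), h1]
  calc Real.exp (-x) - Real.exp (-x) * Real.exp (-(y - x))
      = Real.exp (-x) * (1 - Real.exp (-(y - x))) := by ring
    _ ≤ Real.exp (-m) * (y - x) := by
      apply mul_le_mul h3 (by linarith) _ (exp_pos _).le
      have : Real.exp (-(y - x)) ≤ 1 := Real.exp_le_one_iff.2 (by linarith)
      linarith
    _ = _ := by ring

theorem integrableOn_inv_mul_exp_sub_exp {s : ℝ} (hs : 0 < s) :
    IntegrableOn (fun t : ℝ => t⁻¹ * (Real.exp (-t) - Real.exp (-(t * s)))) (Ioi 0) := by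
  have hm : 0 < min 1 s := lt_min one_pos hs
  have hg : IntegrableOn (fun t : ℝ => |1 - s| * Real.exp (-(min 1 s) * t)) (Ioi 0) :=
    (exp_neg_integrableOn_Ioi 0 hm).const_mul _
  refine Integrable.mono' hg ?_ ?_
  · exact (by fun_prop : Measurable fun t : ℝ =>
      t⁻¹ * (Real.exp (-t) - Real.exp (-(t * s)))).aestronglyMeasurable
  · filter_upwards [ae_restrict_mem measurableSet_Ioi] with t ht
    have ht : 0 < t := ht
    have h := abs_exp_sub_exp_le (x := t) (y := t * s) (m := min 1 s * t)
      (by nlinarith [min_le_left 1 s]) (by nlinarith [min_le_right 1 s])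
    have h2 : |t - t * s| = t * |1 - s| := by
      rw [show t - t * s = t * (1 - s) by ring, abs_mul, abs_of_pos ht]
    rw [norm_mul, Real.norm_eq_abs, Real.norm_eq_abs, abs_inv, abs_of_pos ht, inv_mul_le_iff₀ ht]
    rw [h2] at h
    calc _ ≤ _ := h
      _ = _ := by rw [neg_mul]; ring

theorem integral_inv_mul_exp_sub_exp {s : ℝ} (hs : 0 < s) :
    ∫ t in Ioi (0 : ℝ), t⁻¹ * (Real.exp (-t) - Real.exp (-(t * s))) = Real.log s := by
  have hc : Continuous fun x : ℝ => Real.exp (-x) := by fun_prop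
  have h := Frullani.integral_Ioi_eq (f := fun x : ℝ => Real.exp (-x))
    (a := 1) (b := s) (L := 1) (R := 0)
    (hc.locallyIntegrable.locallyIntegrableOn _) one_pos hs
    ((hc.tendsto' 0 1 (by simp)).mono_left
      nhdsWithin_le_nhds)
    (Real.tendsto_exp_atBot.comp tendsto_neg_atTop_atBot)
    (by simpa [mul_comm s] using integrableOn_inv_mul_exp_sub_exp hs)
  simpa [mul_comm s] using h

theorem integral_abs_inv_mul_exp_sub_exp {s : ℝ} (hs : 0 < s) :
    ∫ t in Ioi (0 : ℝ), ‖t⁻¹ * (Real.exp (-t) - Real.exp (-(t * s)))‖ = |Real.log s| := by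
  rcases le_total 1 s with h | h
  · rw [abs_of_nonneg (log_nonneg h), ← integral_inv_mul_exp_sub_exp hs]
    refine setIntegral_congr_fun measurableSet_Ioi fun t ht => ?_
    have ht : 0 < t := ht
    refine Real.norm_of_nonneg (mul_nonneg (inv_nonneg.2 ht.le) (sub_nonneg.2 ?_))
    exact Real.exp_le_exp.2 (by nlinarith)
  · rw [abs_of_nonpos (log_nonpos hs.le h), ← integral_inv_mul_exp_sub_exp hs, ← integral_neg]
    refine setIntegral_congr_fun measurableSet_Ioi fun t ht => ?_
    have ht : 0 < t := ht
    refine Real.norm_of_nonpos (mul_nonpos_of_nonneg_of_nonpos (inv_nonneg.2 ht.le)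
      (sub_nonpos.2 ?_))
    exact Real.exp_le_exp.2 (by nlinarith)

/-- The Gaussian interaction `∫ exp (-t (x - y)²) dm(x, y)`. -/
noncomputable def gaussEnergy (m : Measure (ℝ × ℝ)) (t : ℝ) : ℝ :=
  ∫ p, Real.exp (-(t * (p.1 - p.2) ^ 2)) ∂m

theorem integrable_exp_neg_mul_sq (m : Measure (ℝ × ℝ)) [IsFiniteMeasure m] {t : ℝ} (ht : 0 ≤ t) :
    Integrable (fun p : ℝ × ℝ => Real.exp (-(t * (p.1 - p.2) ^ 2))) m := by
  refine Integrable.of_bound (C := 1) (by fun_prop) (ae_of_all _ fun p => ?_)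
  rw [Real.norm_of_nonneg (exp_pos _).le, Real.exp_le_one_iff, neg_nonpos]
  positivity

/-- Integrating Frullani's formula
`log x² = ∫₀^∞ (exp (-t) - exp (-t x²)) / t dt` writes the logarithmic energy as a mixture of
Gaussian energies. For fixed `x` the integrand has constant sign, so Fubini's theorem applies as
soon as the logarithmic energy is finite. -/
theorem integral_gaussEnergy {m : Measure (ℝ × ℝ)} [IsProbabilityMeasure m]
    (hm : Integrable (fun p : ℝ × ℝ => Real.log (p.1 - p.2)) m) (hd : ∀ᵐ p ∂m, p.1 ≠ p.2) :
    IntegrableOn (fun t => t⁻¹ * (Real.exp (-t) - gaussEnergy m t)) (Ioi 0) ∧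
      ∫ t in Ioi (0 : ℝ), t⁻¹ * (Real.exp (-t) - gaussEnergy m t)
        = 2 * ∫ p, Real.log (p.1 - p.2) ∂m := by
  set k : (ℝ × ℝ) × ℝ → ℝ := fun q =>
    q.2⁻¹ * (Real.exp (-q.2) - Real.exp (-(q.2 * (q.1.1 - q.1.2) ^ 2))) with hk
  have hlog : ∀ p : ℝ × ℝ, Real.log ((p.1 - p.2) ^ 2) = 2 * Real.log (p.1 - p.2) := fun p => by
    rw [Real.log_pow]; norm_num
  have hpos : ∀ᵐ p ∂m, 0 < (p.1 - p.2) ^ 2 := hd.mono fun p hp => by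
    have := sub_ne_zero.2 hp
    positivity
  have hint : Integrable k (m.prod (volume.restrict (Ioi 0))) := by
    rw [integrable_prod_iff (by fun_prop)]
    refine ⟨hpos.mono fun p hp => integrableOn_inv_mul_exp_sub_exp hp, ?_⟩
    refine (hm.norm.const_mul 2).congr (hpos.mono fun p hp => ?_)
    simp only [hk]
    rw [integral_abs_inv_mul_exp_sub_exp hp, hlog, abs_mul, Real.norm_eq_abs]
    norm_num
  have hinner : ∀ t ∈ Ioi (0 : ℝ), ∫ p, k (p, t) ∂m = t⁻¹ * (Real.exp (-t) - gaussEnergy m t) := by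
    intro t ht
    simp only [hk, gaussEnergy]
    rw [integral_const_mul, integral_sub (integrable_const _)
      (integrable_exp_neg_mul_sq m (le_of_lt ht))]
    simp
  have hright := hint.integral_prod_right
  refine ⟨hright.congr ?_, ?_⟩
  · filter_upwards [ae_restrict_mem measurableSet_Ioi] with t ht
    exact hinner t ht
  · rw [← setIntegral_congr_fun measurableSet_Ioi hinner, ← integral_const_mul,
      ← integral_prod_symm k hint, integral_prod k hint]
    refine integral_congr_ae (hpos.mono fun p hp => ?_)
    simp only [hk]
    rw [integral_inv_mul_exp_sub_exp hp, hlog]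

/-- A Gaussian is the characteristic function of a Gaussian, hence Gaussian interactions are
`L²` products of characteristic functions. -/
theorem gaussEnergy_prod (μ ν : Measure ℝ) [IsProbabilityMeasure μ] [IsProbabilityMeasure ν]
    (t : NNReal) :
    gaussEnergy (μ.prod ν) t
      = ∫ u, (charFun μ u * conj (charFun ν u)).re ∂(gaussianReal 0 (2 * t)) := by
  have hmeas : Measurable fun q : (ℝ × ℝ) × ℝ => cexp (q.2 * (q.1.1 - q.1.2) * I) := by fun_prop
  have hint : Integrable (fun q : (ℝ × ℝ) × ℝ => cexp (q.2 * (q.1.1 - q.1.2) * I))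
      ((μ.prod ν).prod (gaussianReal 0 (2 * t))) := by
    refine Integrable.of_bound (C := 1) hmeas.aestronglyMeasurable (ae_of_all _ fun q => ?_)
    have : ((q.2 : ℂ) * (q.1.1 - q.1.2) * I) = ((q.2 * (q.1.1 - q.1.2) : ℝ) : ℂ) * I := by
      push_cast; ring
    rw [this, norm_exp_ofReal_mul_I]
  have h1 : ∀ p : ℝ × ℝ, ∫ u, cexp (u * (p.1 - p.2) * I) ∂(gaussianReal 0 (2 * t))
      = ((Real.exp (-(t * (p.1 - p.2) ^ 2)) : ℝ) : ℂ) := by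
    intro p
    have h := charFun_gaussianReal (μ := 0) (v := 2 * t) (p.1 - p.2)
    rw [charFun_apply_real] at h
    have h' : ∀ u : ℝ, cexp (u * (p.1 - p.2) * I) = cexp (((p.1 - p.2 : ℝ) : ℂ) * u * I) := by
      intro u
      push_cast
      ring_nf
    simp_rw [h', h]
    push_cast
    ring_nf
  have h2 : ∀ u : ℝ, ∫ p, cexp (u * (p.1 - p.2) * I) ∂(μ.prod ν)
      = charFun μ u * conj (charFun ν u) := by
    intro u
    rw [← charFun_neg, charFun_apply_real, charFun_apply_real, ← integral_prod_mul]
    refine integral_congr_ae (ae_of_all _ fun p => ?_)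
    simp only
    rw [← Complex.exp_add]
    congr 1
    push_cast
    ring
  have h3 : ((gaussEnergy (μ.prod ν) t : ℝ) : ℂ)
      = ∫ u, charFun μ u * conj (charFun ν u) ∂(gaussianReal 0 (2 * t)) := by
    rw [gaussEnergy, ← integral_complex_ofReal]
    simp_rw [← h1, ← h2]
    rw [← integral_prod _ hint, ← integral_prod_symm _ hint]
  have h4 : Integrable (fun u => charFun μ u * conj (charFun ν u)) (gaussianReal 0 (2 * t)) := by
    simp_rw [← h2]
    exact hint.integral_prod_right
  rw [← Complex.ofReal_re (gaussEnergy _ _), h3]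
  exact (integral_re h4).symm

theorem continuous_charFun (μ : Measure ℝ) [IsProbabilityMeasure μ] : Continuous (charFun μ) := by
  have : charFun μ = fun u : ℝ => ∫ x : ℝ, cexp (u * x * I) ∂μ :=
    funext fun u => charFun_apply_real u
  rw [this]
  refine continuous_of_dominated (bound := fun _ => 1) (fun u => by fun_prop) ?_
    (integrable_const _) (ae_of_all _ fun x => by fun_prop)
  refine fun u => ae_of_all _ fun x => ?_
  rw [← ofReal_mul, norm_exp_ofReal_mul_I]

/-- The Gaussian interaction of `μ - ν` with itself is the squared `L²` norm of the difference of the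
characteristic functions with respect to a Gaussian measure, hence nonnegative. -/
theorem gaussEnergy_diff (μ ν : Measure ℝ) [IsProbabilityMeasure μ] [IsProbabilityMeasure ν]
    (t : NNReal) :
    gaussEnergy (μ.prod μ) t + gaussEnergy (ν.prod ν) t - 2 * gaussEnergy (μ.prod ν) t
      = ∫ u, ‖charFun μ u - charFun ν u‖ ^ 2 ∂(gaussianReal 0 (2 * t)) := by
  have hi : ∀ (μ ν : Measure ℝ) [IsProbabilityMeasure μ] [IsProbabilityMeasure ν],
      Integrable (fun u => (charFun μ u * conj (charFun ν u)).re) (gaussianReal 0 (2 * t)) := by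
    intro μ ν _ _
    have c1 := continuous_charFun μ
    have c2 := continuous_charFun ν
    have : Continuous fun u => (charFun μ u * conj (charFun ν u)).re := by fun_prop
    refine Integrable.of_bound (C := 1) this.aestronglyMeasurable (ae_of_all _ fun u => ?_)
    refine (abs_re_le_norm _).trans ?_
    rw [norm_mul, RCLike.norm_conj]
    exact mul_le_one₀ (norm_charFun_le_one _) (norm_nonneg _) (norm_charFun_le_one _)
  have hadd : Integrable (fun u => (charFun μ u * conj (charFun μ u)).re +
      (charFun ν u * conj (charFun ν u)).re) (gaussianReal 0 (2 * t)) := (hi μ μ).add (hi ν ν)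
  rw [gaussEnergy_prod, gaussEnergy_prod, gaussEnergy_prod, ← integral_const_mul,
    ← integral_add (hi _ _) (hi _ _), ← integral_sub hadd ((hi _ _).const_mul 2)]
  refine integral_congr_ae (ae_of_all _ fun u => ?_)
  simp only [Complex.sq_norm, normSq_sub]
  rw [Complex.mul_conj, Complex.mul_conj]
  simp

/-- The logarithmic energy of the difference of two probability measures is nonnegative, and it
vanishes only if the two measures are equal. -/
theorem logEnergy_sub {μ ν : Measure ℝ} [IsProbabilityMeasure μ] [IsProbabilityMeasure ν]
    (hμ : Integrable (fun p : ℝ × ℝ => Real.log (p.1 - p.2)) (μ.prod μ))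
    (hν : Integrable (fun p : ℝ × ℝ => Real.log (p.1 - p.2)) (ν.prod ν))
    (hμν : Integrable (fun p : ℝ × ℝ => Real.log (p.1 - p.2)) (μ.prod ν))
    (dμ : ∀ᵐ p ∂(μ.prod μ), p.1 ≠ p.2) (dν : ∀ᵐ p ∂(ν.prod ν), p.1 ≠ p.2)
    (dμν : ∀ᵐ p ∂(μ.prod ν), p.1 ≠ p.2) :
    (∫ p, Real.log (p.1 - p.2) ∂(μ.prod μ)) + (∫ p, Real.log (p.1 - p.2) ∂(ν.prod ν))
        ≤ 2 * ∫ p, Real.log (p.1 - p.2) ∂(μ.prod ν) ∧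
      ((∫ p, Real.log (p.1 - p.2) ∂(μ.prod μ)) + (∫ p, Real.log (p.1 - p.2) ∂(ν.prod ν))
        = 2 * ∫ p, Real.log (p.1 - p.2) ∂(μ.prod ν) → μ = ν) := by
  obtain ⟨i1, e1⟩ := integral_gaussEnergy hμ dμ
  obtain ⟨i2, e2⟩ := integral_gaussEnergy hν dν
  obtain ⟨i3, e3⟩ := integral_gaussEnergy hμν dμν
  set N : ℝ → ℝ := fun t =>
    gaussEnergy (μ.prod μ) t + gaussEnergy (ν.prod ν) t - 2 * gaussEnergy (μ.prod ν) t with hN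
  have hNn : ∀ t ∈ Ioi (0 : ℝ), N t
      = ∫ u, ‖charFun μ u - charFun ν u‖ ^ 2 ∂(gaussianReal 0 (2 * t.toNNReal)) := by
    intro t ht
    rw [← gaussEnergy_diff, Real.coe_toNNReal t (le_of_lt ht)]
  have hfun : (fun t : ℝ => t⁻¹ * N t) = fun t =>
      2 * (t⁻¹ * (Real.exp (-t) - gaussEnergy (μ.prod ν) t))
        - (t⁻¹ * (Real.exp (-t) - gaussEnergy (μ.prod μ) t)
        + t⁻¹ * (Real.exp (-t) - gaussEnergy (ν.prod ν) t)) := by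
    funext t
    simp only [hN]
    ring
  have hint : IntegrableOn (fun t : ℝ => t⁻¹ * N t) (Ioi 0) := by
    rw [hfun]
    exact (i3.const_mul 2).sub (i1.add i2)
  have heq : ∫ t in Ioi (0 : ℝ), t⁻¹ * N t
      = 2 * (2 * ∫ p, Real.log (p.1 - p.2) ∂(μ.prod ν))
        - (2 * (∫ p, Real.log (p.1 - p.2) ∂(μ.prod μ))
        + 2 * ∫ p, Real.log (p.1 - p.2) ∂(ν.prod ν)) := by
    have hadd : IntegrableOn (fun t => t⁻¹ * (Real.exp (-t) - gaussEnergy (μ.prod μ) t)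
        + t⁻¹ * (Real.exp (-t) - gaussEnergy (ν.prod ν) t)) (Ioi 0) := i1.add i2
    rw [hfun, integral_sub (i3.const_mul 2) hadd, integral_const_mul, e3,
      integral_add i1 i2, e1, e2]
  have hnn : ∀ t ∈ Ioi (0 : ℝ), 0 ≤ t⁻¹ * N t := by
    intro t ht
    rw [hNn t ht]
    exact mul_nonneg (inv_nonneg.2 (le_of_lt ht)) (integral_nonneg fun u => by positivity)
  have hnn' := setIntegral_nonneg (μ := volume) measurableSet_Ioi hnn
  refine ⟨by linarith, fun h => ?_⟩
  have h0 : ∫ t in Ioi (0 : ℝ), t⁻¹ * N t = 0 := by rw [heq]; linarith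
  rw [setIntegral_eq_zero_iff_of_nonneg_ae ((ae_restrict_iff' measurableSet_Ioi).2
    (ae_of_all _ hnn)) hint] at h0
  have hpos : (volume.restrict (Ioi (0 : ℝ))) ≠ 0 := by simp
  have : (ae (volume.restrict (Ioi (0 : ℝ)))).NeBot := ae_neBot.2 hpos
  obtain ⟨t, ht0, ht⟩ := (h0.and (ae_restrict_mem measurableSet_Ioi)).exists
  have ht : 0 < t := ht
  have hNt : N t = 0 := by
    rcases mul_eq_zero.1 ht0 with h | h
    · exact absurd h (inv_ne_zero ht.ne')
    · exact h
  rw [hNn t ht] at hNt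
  have c1 := continuous_charFun μ
  have c2 := continuous_charFun ν
  have hc : Continuous fun u => ‖charFun μ u - charFun ν u‖ ^ 2 := by fun_prop
  have hi : Integrable (fun u => ‖charFun μ u - charFun ν u‖ ^ 2)
      (gaussianReal 0 (2 * t.toNNReal)) := by
    refine Integrable.of_bound (C := 2 ^ 2) hc.aestronglyMeasurable (ae_of_all _ fun u => ?_)
    rw [norm_pow, norm_norm]
    refine pow_le_pow_left₀ (norm_nonneg _) ((norm_sub_le _ _).trans ?_) 2
    linarith [norm_charFun_le_one (μ := μ) u, norm_charFun_le_one (μ := ν) u]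
  rw [integral_eq_zero_iff_of_nonneg (fun u => by positivity) hi] at hNt
  have hae : charFun μ =ᵐ[volume] charFun ν := by
    have hv : 2 * t.toNNReal ≠ 0 := by simpa using ht
    filter_upwards [(gaussianReal_absolutelyContinuous' 0 hv).ae_le hNt] with u hu
    simpa [sub_eq_zero] using hu
  exact Measure.ext_of_charFun ((c1.ae_eq_iff_eq volume c2).1 hae)

end LogGas

/-! ### The change of variables to the unit circle -/

namespace LogGas

open Real Set Filter Topology Complex ComplexConjugate Metric

/-- The density on the unit circle, with respect to the uniform probability measure, that
corresponds to `ν_{β,c}` when `β = 4 q²`, `c = p² - q²` and `ρ = q / p`. On the circle it is equal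
to `2 (Im z)² / ‖1 + ρ z‖²`; it is written here as a combination of `1`, `Re z` and a Poisson
kernel, against which harmonic functions can be integrated. For `ρ = 1` the Poisson kernel has no
meaning, but its coefficient vanishes. -/
noncomputable def weight (ρ : ℝ) (z : ℂ) : ℝ :=
  1 / ρ ^ 2 - z.re / ρ + (1 - 1 / ρ ^ 2) / 2 * (1 + poissonKernel 0 (-ρ : ℂ) z)

theorem norm_neg_ofReal_lt {ρ : ℝ} (h0 : 0 < ρ) (h1 : ρ < 1) : ‖(-ρ : ℂ)‖ < 1 := by
  rwa [norm_neg, norm_real, Real.norm_eq_abs, abs_of_pos h0]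

theorem continuousOn_weight {ρ : ℝ} (h0 : 0 < ρ) (h1 : ρ ≤ 1) :
    ContinuousOn (weight ρ) (sphere 0 1) := by
  unfold weight
  rcases h1.lt_or_eq with h1 | rfl
  · have := continuousOn_poissonKernel (norm_neg_ofReal_lt h0 h1)
    fun_prop
  · simp only [one_pow, div_one, sub_self, zero_div, zero_mul, add_zero]
    fun_prop

theorem circleAverage_weight_mul {ρ : ℝ} (h0 : 0 < ρ) (h1 : ρ ≤ 1) {f : ℂ → ℝ}
    (hf : CircleIntegrable f 0 1) {m₀ m₁ m₂ : ℝ} (e₀ : circleAverage f 0 1 = m₀)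
    (e₁ : circleAverage (fun z => z.re * f z) 0 1 = m₁)
    (e₂ : ρ < 1 → circleAverage (fun z => poissonKernel 0 (-ρ : ℂ) z * f z) 0 1 = m₂) :
    circleAverage (fun z => weight ρ z * f z) 0 1
      = m₀ / ρ ^ 2 - m₁ / ρ + (1 - 1 / ρ ^ 2) / 2 * (m₀ + m₂) := by
  have i1 : CircleIntegrable (fun z : ℂ => z.re * f z) 0 1 :=
    circleIntegrable_mul (by fun_prop) hf
  rcases h1.lt_or_eq with h1 | rfl
  · have i2 := circleIntegrable_mul (continuousOn_poissonKernel (norm_neg_ofReal_lt h0 h1)) hf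
    have hfun : (fun z => weight ρ z * f z) = fun z =>
        ((1 / ρ ^ 2 + (1 - 1 / ρ ^ 2) / 2) • f z + (-(1 / ρ)) • (z.re * f z))
          + ((1 - 1 / ρ ^ 2) / 2) • (poissonKernel 0 (-ρ : ℂ) z * f z) := by
      funext z
      simp only [weight, smul_eq_mul]
      ring
    have j0 : CircleIntegrable (fun z => (1 / ρ ^ 2 + (1 - 1 / ρ ^ 2) / 2) • f z) 0 1 :=
      hf.const_smul
    have j1 : CircleIntegrable (fun z => (-(1 / ρ)) • (z.re * f z)) 0 1 := i1.const_smul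
    have j2 : CircleIntegrable (fun z => ((1 - 1 / ρ ^ 2) / 2) •
      (poissonKernel 0 (-ρ : ℂ) z * f z)) 0 1 := i2.const_smul
    have j01 : CircleIntegrable (fun z => (1 / ρ ^ 2 + (1 - 1 / ρ ^ 2) / 2) • f z
      + (-(1 / ρ)) • (z.re * f z)) 0 1 := j0.add j1
    rw [hfun, circleAverage_fun_add j01 j2, circleAverage_fun_add j0 j1, circleAverage_fun_smul,
      circleAverage_fun_smul, circleAverage_fun_smul, e₀, e₁, e₂ h1]
    simp only [smul_eq_mul]
    ring
  · have hfun : (fun z => weight 1 z * f z) = fun z => f z - z.re * f z := by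
      funext z
      simp only [weight]
      ring
    rw [hfun, circleAverage_fun_sub hf i1, e₀, e₁]
    ring

theorem circleAverage_weight {ρ : ℝ} (h0 : 0 < ρ) (h1 : ρ ≤ 1) :
    circleAverage (weight ρ) 0 1 = 1 := by
  have h := circleAverage_weight_mul h0 h1 (f := fun _ => 1) (m₀ := 1) (m₁ := 0) (m₂ := 1)
    (circleIntegrable_const _ _ _) (circleAverage_const _ _ _) (by simpa using circleAverage_re)
    (fun h => by simpa using circleAverage_poissonKernel (norm_neg_ofReal_lt h0 h))
  simp only [mul_one] at h
  rw [h]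
  ring

theorem circleAverage_weight_mul_re {ρ : ℝ} (h0 : 0 < ρ) (h1 : ρ ≤ 1) :
    circleAverage (fun z => weight ρ z * z.re) 0 1 = -ρ / 2 := by
  have h := circleAverage_weight_mul h0 h1 (f := fun z => z.re)
    (ContinuousOn.circleIntegrable' (by fun_prop)) circleAverage_re circleAverage_re_mul_re
    (fun h => circleAverage_poissonKernel_mul_re (norm_neg_ofReal_lt h0 h))
  rw [h]
  simp only [neg_re, ofReal_re]
  field_simp
  ring

theorem circleAverage_weight_mul_log_norm_sub {ρ : ℝ} (h0 : 0 < ρ) (h1 : ρ ≤ 1) {w : ℂ}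
    (hw : 1 ≤ ‖w‖) :
    circleAverage (fun z => weight ρ z * Real.log ‖z - w‖) 0 1
      = Real.log ‖w‖ + (w⁻¹).re / (2 * ρ)
        + (1 - 1 / ρ ^ 2) / 2 * (Real.log ‖w + ρ‖ - Real.log ‖w‖) := by
  have h := circleAverage_weight_mul h0 h1 (f := fun z => Real.log ‖z - w‖)
    (m₀ := Real.log ‖w‖) (m₂ := Real.log ‖w + ρ‖)
    (circleIntegrable_log_norm_sub_const 1)
    (by rw [circleAverage_log_norm_sub_const_eq_posLog, Real.posLog_eq_log (by simpa using hw)])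
    (circleAverage_re_mul_log_norm_sub hw)
    (fun h => by
      rw [circleAverage_poissonKernel_mul_log_norm_sub (norm_neg_ofReal_lt h0 h) hw, ← norm_neg]
      congr 2
      ring)
  rw [h]
  field_simp
  ring

/-- The average of a function that is symmetric about the real axis is its average over the upper
half circle. -/
theorem circleAverage_of_conj {f : ℂ → ℝ} (hi : CircleIntegrable f 0 1)
    (hf : ∀ z, f (conj z) = f z) :
    circleAverage f 0 1 = π⁻¹ * ∫ t in Ioo 0 π, f (circleMap 0 1 t) := by
  have hi' : IntervalIntegrable (fun t => f (circleMap 0 1 t)) volume 0 (2 * π) := hi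
  have hπ := Real.pi_pos
  have i1 := hi'.mono_set (c := 0) (d := π) (by
    rw [uIcc_of_le hπ.le, uIcc_of_le (by positivity)]
    exact Icc_subset_Icc le_rfl (by linarith))
  have i2 := hi'.mono_set (c := π) (d := 2 * π) (by
    rw [uIcc_of_le (by linarith), uIcc_of_le (by positivity)]
    exact Icc_subset_Icc hπ.le le_rfl)
  have h2 : ∫ t in π..2 * π, f (circleMap 0 1 t) = ∫ t in (0 : ℝ)..π, f (circleMap 0 1 t) := by
    have h := intervalIntegral.integral_comp_sub_left (a := 0) (b := π)
      (fun t => f (circleMap 0 1 t)) (2 * π)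
    rw [show 2 * π - π = π by ring, sub_zero] at h
    rw [← h]
    refine intervalIntegral.integral_congr fun t _ => ?_
    rw [← hf (circleMap 0 1 t)]
    congr 1
    rw [sub_eq_neg_add, (periodic_circleMap 0 1) (-t)]
    simp [circleMap, ← Complex.exp_conj]
  rw [circleAverage, ← intervalIntegral.integral_add_adjacent_intervals i1 i2, h2,
    intervalIntegral.integral_of_le hπ.le, integral_Ioc_eq_integral_Ioo, smul_eq_mul]
  field_simp
  ring

variable {p q : ℝ}

theorem sqrt_one_add_div (hq : 0 < q) (hqp : q ≤ p) :
    √(1 + 4 * (p ^ 2 - q ^ 2) / (4 * q ^ 2)) = p / q := by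
  rw [show 1 + 4 * (p ^ 2 - q ^ 2) / (4 * q ^ 2) = (p / q) ^ 2 by field_simp; ring]
  exact Real.sqrt_sq (by have := hq.le.trans hqp; positivity)

theorem a_eq (hq : 0 < q) (hqp : q ≤ p) : a (4 * q ^ 2) (p ^ 2 - q ^ 2) = p - q := by
  rw [a, sqrt_one_add_div hq hqp, ← Real.sqrt_mul (by positivity),
    show 4 * q ^ 2 / 2 * (1 + 2 * (p ^ 2 - q ^ 2) / (4 * q ^ 2) - p / q) = (p - q) ^ 2 by
      field_simp; ring]
  exact Real.sqrt_sq (by linarith)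

theorem b_eq (hq : 0 < q) (hqp : q ≤ p) : b (4 * q ^ 2) (p ^ 2 - q ^ 2) = p + q := by
  rw [b, sqrt_one_add_div hq hqp, ← Real.sqrt_mul (by positivity),
    show 4 * q ^ 2 / 2 * (1 + 2 * (p ^ 2 - q ^ 2) / (4 * q ^ 2) + p / q) = (p + q) ^ 2 by
      field_simp; ring]
  exact Real.sqrt_sq (by linarith)

theorem density_nonneg {β : ℝ} (hβ : 0 < β) (c t : ℝ) : 0 ≤ density β c t := by
  refine indicator_nonneg (fun t _ => ?_) t
  have := Real.pi_pos
  positivity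

theorem density_abs (β c t : ℝ) : density β c |t| = density β c t := by
  have hS : |t| ∈ S β c ↔ t ∈ S β c := by
    rcases abs_choice t with h | h <;> rw [h]
    simp only [S, mem_union, mem_Icc]
    constructor <;> rintro (⟨h1, h2⟩ | ⟨h1, h2⟩)
    · exact Or.inr ⟨by linarith, by linarith⟩
    · exact Or.inl ⟨by linarith, by linarith⟩
    · exact Or.inr ⟨by linarith, by linarith⟩
    · exact Or.inl ⟨by linarith, by linarith⟩
  by_cases h : t ∈ S β c
  · simp only [density]
    rw [indicator_of_mem h, indicator_of_mem (hS.2 h), abs_abs, sq_abs]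
  · simp only [density]
    rw [indicator_of_notMem h, indicator_of_notMem (fun h' => h (hS.1 h'))]

theorem measurable_density (β c : ℝ) : Measurable (density β c) := by
  refine Measurable.indicator (by fun_prop) ?_
  exact measurableSet_Icc.union measurableSet_Icc

theorem density_eq (hq : 0 < q) (hqp : q ≤ p) {t : ℝ} (h1 : p - q < t) (h2 : t < p + q) :
    density (4 * q ^ 2) (p ^ 2 - q ^ 2) t
      = 2 / (π * (4 * q ^ 2)) * (1 / t) * √((t ^ 2 - (p - q) ^ 2) * ((p + q) ^ 2 - t ^ 2)) := by
  have ht : 0 < t := by linarith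
  have hS : t ∈ S (4 * q ^ 2) (p ^ 2 - q ^ 2) := by
    refine Or.inr ?_
    rw [a_eq hq hqp, b_eq hq hqp]
    exact ⟨h1.le, h2.le⟩
  rw [density, indicator_of_mem hS, a_eq hq hqp, b_eq hq hqp, abs_of_pos ht]

theorem density_eq_zero (hq : 0 < q) (hqp : q ≤ p) {t : ℝ} (h0 : 0 < t)
    (h : t ∉ Ioo (p - q) (p + q)) : density (4 * q ^ 2) (p ^ 2 - q ^ 2) t = 0 := by
  by_cases hS : t ∈ S (4 * q ^ 2) (p ^ 2 - q ^ 2)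
  · rw [density, indicator_of_mem hS]
    rw [S, a_eq hq hqp, b_eq hq hqp] at hS
    rw [a_eq hq hqp, b_eq hq hqp]
    rcases hS with ⟨h1, h2⟩ | ⟨h1, h2⟩
    · linarith
    · have : t = p - q ∨ t = p + q := by
        by_contra! hne
        exact h ⟨lt_of_le_of_ne h1 (Ne.symm hne.1), lt_of_le_of_ne h2 hne.2⟩
      rcases this with rfl | rfl <;> simp
  · rw [density, indicator_of_notMem hS]

theorem one_add_sq_add_cos_pos {ρ t : ℝ} (h0 : 0 < ρ) (ht : t ∈ Ioo 0 π) :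
    0 < 1 + ρ ^ 2 + 2 * ρ * Real.cos t := by
  have h : -1 < Real.cos t := by
    rw [← Real.cos_pi]
    exact Real.cos_lt_cos_of_nonneg_of_le_pi ht.1.le le_rfl ht.2
  nlinarith [sq_nonneg (ρ - 1), mul_pos h0 (by linarith : 0 < Real.cos t + 1)]

theorem circleMap_re (t : ℝ) : (circleMap 0 1 t).re = Real.cos t := by
  simp [circleMap, Complex.exp_re]

theorem weight_circleMap {ρ t : ℝ} (h0 : 0 < ρ) (ht : t ∈ Ioo 0 π) :
    weight ρ (circleMap 0 1 t) = 2 * Real.sin t ^ 2 / (1 + ρ ^ 2 + 2 * ρ * Real.cos t) := by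
  have hpos := one_add_sq_add_cos_pos h0 ht
  have hn : ‖circleMap 0 1 t - 0 - (-ρ - 0 : ℂ)‖ ^ 2 = 1 + ρ ^ 2 + 2 * ρ * Real.cos t := by
    rw [Complex.sq_norm, normSq_apply]
    simp [circleMap, Complex.exp_re, Complex.exp_im]
    linear_combination Real.sin_sq_add_cos_sq t
  have hP : poissonKernel 0 (-ρ : ℂ) (circleMap 0 1 t)
      = (1 - ρ ^ 2) / (1 + ρ ^ 2 + 2 * ρ * Real.cos t) := by
    rw [poissonKernel_def, hn]
    simp
  rw [weight, hP, circleMap_re, Real.sin_sq]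
  generalize hX : 1 + ρ ^ 2 + 2 * ρ * Real.cos t = X at hpos ⊢
  have hc : Real.cos t = (X - 1 - ρ ^ 2) / (2 * ρ) := by
    rw [← hX]
    field_simp
    ring
  rw [hc]
  field_simp
  ring

theorem weight_conj (ρ : ℝ) (z : ℂ) : weight ρ (conj z) = weight ρ z := by
  have : ‖conj z - 0 - (-ρ - 0 : ℂ)‖ = ‖z - 0 - (-ρ - 0 : ℂ)‖ := by
    rw [← RCLike.norm_conj]
    simp
  rw [weight, weight, poissonKernel_def, poissonKernel_def, this]
  simp

/-- The substitution `|y|² = ‖p + q e^{it}‖²` in integrals of even functions. -/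
theorem integral_density (hq : 0 < q) (hqp : q ≤ p) (g : ℝ → ℝ)
    (hg : CircleIntegrable
      (fun z => weight (q / p) z * g (p ^ 2 + q ^ 2 + 2 * p * q * z.re)) 0 1) :
    ∫ y, density (4 * q ^ 2) (p ^ 2 - q ^ 2) y * g (y ^ 2)
      = circleAverage (fun z => weight (q / p) z * g (p ^ 2 + q ^ 2 + 2 * p * q * z.re)) 0 1 := by
  have hp : 0 < p := hq.trans_le hqp
  have hpq : 0 < p * q := mul_pos hp hq
  have hρ : 0 < q / p := div_pos hq hp
  set D := density (4 * q ^ 2) (p ^ 2 - q ^ 2) with hD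
  have h1 : ∫ y, D y * g (y ^ 2) = 2 * ∫ y in Ioi 0, D y * g (y ^ 2) := by
    rw [← integral_comp_abs (f := fun y => D y * g (y ^ 2))]
    refine integral_congr_ae (ae_of_all _ fun y => ?_)
    simp only [hD, density_abs, sq_abs]
  have h2 : ∫ y in Ioi 0, D y * g (y ^ 2) = ∫ y in Ioo (p - q) (p + q), D y * g (y ^ 2) := by
    refine setIntegral_eq_of_subset_of_forall_sdiff_eq_zero measurableSet_Ioi
      (fun y hy => lt_of_le_of_lt (by linarith) hy.1) fun y hy => ?_
    rw [hD, density_eq_zero hq hqp hy.1 hy.2, zero_mul]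
  set u : ℝ → ℝ := fun t => p ^ 2 + q ^ 2 + 2 * p * q * Real.cos t with hu
  have hupos : ∀ t ∈ Ioo 0 π, 0 < u t := by
    intro t ht
    have h := one_add_sq_add_cos_pos hρ ht
    have : u t = p ^ 2 * (1 + (q / p) ^ 2 + 2 * (q / p) * Real.cos t) := by
      simp only [hu]
      field_simp
    rw [this]
    positivity
  set T : ℝ → ℝ := fun t => √(u t) with hT
  have himage : T '' Ioo 0 π = Ioo (p - q) (p + q) := by
    ext y
    constructor
    · rintro ⟨t, ht, rfl⟩
      have hc1 : -1 < Real.cos t := by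
        rw [← Real.cos_pi]
        exact Real.cos_lt_cos_of_nonneg_of_le_pi ht.1.le le_rfl ht.2
      have hc2 : Real.cos t < 1 := by
        rw [← Real.cos_zero]
        exact Real.cos_lt_cos_of_nonneg_of_le_pi le_rfl ht.2.le ht.1
      constructor
      · rw [hT]
        refine Real.lt_sqrt_of_sq_lt ?_
        simp only [hu]
        nlinarith
      · rw [hT, Real.sqrt_lt' (by linarith)]
        simp only [hu]
        nlinarith
    · rintro ⟨hy1, hy2⟩
      have hy0 : 0 < y := by linarith
      have hx1 : -1 < (y ^ 2 - p ^ 2 - q ^ 2) / (2 * p * q) := by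
        rw [lt_div_iff₀ (by positivity)]
        nlinarith
      have hx2 : (y ^ 2 - p ^ 2 - q ^ 2) / (2 * p * q) < 1 := by
        rw [div_lt_iff₀ (by positivity)]
        nlinarith
      refine ⟨Real.arccos ((y ^ 2 - p ^ 2 - q ^ 2) / (2 * p * q)), ⟨?_, ?_⟩, ?_⟩
      · exact Real.arccos_pos.2 hx2
      · exact lt_of_le_of_ne (Real.arccos_le_pi _) fun h => by
          rw [Real.arccos_eq_pi] at h
          linarith
      · simp only [hT, hu]
        rw [Real.cos_arccos hx1.le hx2.le,
          show p ^ 2 + q ^ 2 + 2 * p * q * ((y ^ 2 - p ^ 2 - q ^ 2) / (2 * p * q)) = y ^ 2 by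
            field_simp; ring]
        exact Real.sqrt_sq hy0.le
  have hinj : InjOn T (Ioo 0 π) := by
    intro s hs t ht hst
    have h : u s = u t := by
      rw [← Real.sq_sqrt (hupos s hs).le, ← Real.sq_sqrt (hupos t ht).le]
      exact congrArg (· ^ 2) hst
    simp only [hu] at h
    have : Real.cos s = Real.cos t := by
      have h' : 2 * p * q * Real.cos s = 2 * p * q * Real.cos t := by linarith
      exact mul_left_cancel₀ (by positivity) h'
    exact Real.injOn_cos ⟨hs.1.le, hs.2.le⟩ ⟨ht.1.le, ht.2.le⟩ this
  have hderiv : ∀ t ∈ Ioo 0 π,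
      HasDerivWithinAt T (2 * p * q * (-Real.sin t) / (2 * √(u t))) (Ioo 0 π) t := by
    intro t ht
    exact ((((Real.hasDerivAt_cos t).const_mul (2 * p * q)).const_add (p ^ 2 + q ^ 2)).sqrt
      (hupos t ht).ne').hasDerivWithinAt
  rw [h1, h2, ← himage, integral_image_eq_integral_abs_deriv_smul measurableSet_Ioo hderiv hinj,
    circleAverage_of_conj hg (fun z => by rw [weight_conj, conj_re]), ← integral_const_mul,
    ← integral_const_mul]
  refine setIntegral_congr_fun measurableSet_Ioo fun t ht => ?_
  have hTt : T t ∈ Ioo (p - q) (p + q) := himage ▸ mem_image_of_mem T ht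
  have hs := Real.sin_pos_of_mem_Ioo ht
  have hu0 := hupos t ht
  have hT2 : T t ^ 2 = u t := Real.sq_sqrt hu0.le
  have hT0 : 0 < T t := Real.sqrt_pos.2 hu0
  have hsqrt : √((T t ^ 2 - (p - q) ^ 2) * ((p + q) ^ 2 - T t ^ 2)) = 2 * p * q * Real.sin t := by
    rw [hT2, show (u t - (p - q) ^ 2) * ((p + q) ^ 2 - u t) = (2 * p * q * Real.sin t) ^ 2 by
      simp only [hu]
      linear_combination (-4) * (p * q) ^ 2 * Real.sin_sq_add_cos_sq t]
    exact Real.sqrt_sq (by positivity)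
  have habs : |2 * p * q * (-Real.sin t) / (2 * √(u t))| = p * q * Real.sin t / T t := by
    rw [show 2 * p * q * (-Real.sin t) / (2 * √(u t)) = -(p * q * Real.sin t / T t) by
      simp only [hT]; field_simp, abs_neg, abs_of_pos (by positivity)]
  have hw : 1 + (q / p) ^ 2 + 2 * (q / p) * Real.cos t = T t ^ 2 / p ^ 2 := by
    rw [hT2]
    simp only [hu]
    field_simp
  simp only [smul_eq_mul]
  rw [habs, hD, density_eq hq hqp hTt.1 hTt.2, hsqrt, weight_circleMap hρ ht, hw, circleMap_re,
    show p ^ 2 + q ^ 2 + 2 * p * q * Real.cos t = T t ^ 2 from hT2.symm]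
  field_simp
  ring

end LogGas

/-! ### The measure `ν_{β,c}` and its logarithmic potential -/

namespace LogGas

open Real Set Filter Topology Complex ComplexConjugate Metric

variable {p q : ℝ}

theorem density_le {β : ℝ} (hβ : 0 < β) (c t : ℝ) :
    density β c t ≤ 2 / (π * β) * b β c := by
  have hπ := Real.pi_pos
  have hb : 0 ≤ b β c := by unfold b; positivity
  by_cases h : t ∈ S β c
  · rw [density, indicator_of_mem h]
    rcases eq_or_ne t 0 with rfl | ht
    · simp only [abs_zero, div_zero, mul_zero, zero_mul]
      positivity
    · have h1 : √((t ^ 2 - a β c ^ 2) * (b β c ^ 2 - t ^ 2)) ≤ |t| * b β c := by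
        rw [Real.sqrt_le_left (by positivity), mul_pow, sq_abs]
        nlinarith [sq_nonneg (a β c), sq_nonneg (b β c), sq_nonneg t, sq_nonneg (t ^ 2),
          mul_nonneg (sq_nonneg (a β c)) (sq_nonneg t), mul_nonneg (sq_nonneg (a β c))
          (sub_nonneg.2 (show t ^ 2 ≤ b β c ^ 2 from by
            rw [← sq_abs t]
            refine pow_le_pow_left₀ (abs_nonneg t) (abs_le.2 ?_) 2
            have ha : 0 ≤ a β c := by unfold a; positivity
            rcases h with h | h
            · exact ⟨h.1, by linarith [h.2]⟩
            · exact ⟨by linarith [h.1], h.2⟩))]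
      rw [mul_assoc]
      refine mul_le_mul_of_nonneg_left ?_ (by positivity)
      rw [one_div, inv_mul_le_iff₀ (abs_pos.2 ht)]
      exact h1
  · rw [density, indicator_of_notMem h]
    positivity

theorem integral_nu {β : ℝ} (hβ : 0 < β) (c : ℝ) (f : ℝ → ℝ) :
    ∫ y, f y ∂(nu β c) = ∫ y, density β c y * f y := by
  rw [nu, integral_withDensity_eq_integral_toReal_smul
    (measurable_density β c).ennreal_ofReal (ae_of_all _ fun _ => ENNReal.ofReal_lt_top)]
  simp only [ENNReal.toReal_ofReal (density_nonneg hβ c _), smul_eq_mul]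

theorem ae_nu_abs_le (β c : ℝ) : ∀ᵐ y ∂(nu β c), |y| ≤ b β c := by
  rw [nu, ae_withDensity_iff (measurable_density β c).ennreal_ofReal]
  refine ae_of_all _ fun y hy => ?_
  have h : y ∈ S β c := by
    by_contra h
    simp [density, indicator_of_notMem h] at hy
  have ha : 0 ≤ a β c := by unfold a; positivity
  rw [abs_le]
  rcases h with h | h
  · exact ⟨h.1, by linarith [h.2, h.1]⟩
  · exact ⟨by linarith [h.1, h.2], h.2⟩

instance (β c : ℝ) : NullSingletonClass (nu β c) :=
  ⟨fun x => withDensity_absolutelyContinuous _ _ (measure_singleton x)⟩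

theorem isProbabilityMeasure_nu (hq : 0 < q) (hqp : q ≤ p) :
    IsProbabilityMeasure (nu (4 * q ^ 2) (p ^ 2 - q ^ 2)) := by
  have hρ : 0 < q / p := div_pos hq (hq.trans_le hqp)
  have hρ1 : q / p ≤ 1 := (div_le_one (hq.trans_le hqp)).2 hqp
  have h := integral_density hq hqp (fun _ => 1) (by
    simp only [mul_one]
    exact (continuousOn_weight hρ hρ1).circleIntegrable zero_le_one)
  simp only [mul_one] at h
  rw [circleAverage_weight hρ hρ1] at h
  have hi : Integrable (density (4 * q ^ 2) (p ^ 2 - q ^ 2)) := by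
    by_contra hn
    rw [integral_undef hn] at h
    exact zero_ne_one h
  refine ⟨?_⟩
  rw [nu, withDensity_apply _ MeasurableSet.univ, setLIntegral_univ,
    ← ofReal_integral_eq_lintegral_ofReal hi
      (ae_of_all _ fun y => density_nonneg (by positivity) _ y), h, ENNReal.ofReal_one]

/-- As the density is bounded, the logarithmic singularity is uniformly integrable. -/
theorem exists_lintegral_log_sub_le {β c : ℝ} (hβ : 0 < β) [IsProbabilityMeasure (nu β c)] :
    ∃ M : ℝ, 0 ≤ M ∧
      ∀ x, ∫⁻ y, ‖Real.log (x - y)‖ₑ ∂(nu β c) ≤ ENNReal.ofReal (|x| + M) := by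
  set h : ℝ → ENNReal := (Ioc (-1) 1).indicator fun s => ‖Real.log s‖ₑ with hh
  have hmeas : Measurable h := Measurable.indicator (by fun_prop) measurableSet_Ioc
  have hfin : ∫⁻ s, h s ≠ ⊤ := by
    rw [hh, lintegral_indicator measurableSet_Ioc]
    have := (intervalIntegrable_iff_integrableOn_Ioc_of_le (by norm_num : (-1 : ℝ) ≤ 1)).1
      (intervalIntegral.intervalIntegrable_log' (a := -1) (b := 1))
    exact this.hasFiniteIntegral.ne
  set K : ℝ := 2 / (π * β) * b β c with hK
  have hb : 0 ≤ b β c := by unfold b; positivity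
  have hle : ∀ s : ℝ, ‖Real.log s‖ₑ ≤ ENNReal.ofReal |s| + h s := by
    intro s
    by_cases hs : s ∈ Ioc (-1 : ℝ) 1
    · rw [hh, indicator_of_mem hs]
      exact le_add_self
    · have h1 : 1 ≤ |s| := by
        by_contra hlt
        have := abs_lt.1 (not_le.1 hlt)
        exact hs ⟨this.1, this.2.le⟩
      refine le_trans ?_ le_self_add
      rw [Real.enorm_eq_ofReal_abs, ← Real.log_abs, abs_of_nonneg (Real.log_nonneg h1)]
      exact ENNReal.ofReal_le_ofReal
        ((Real.log_le_sub_one_of_pos (by linarith)).trans (by linarith))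
  refine ⟨b β c + (ENNReal.ofReal K * ∫⁻ s, h s).toReal, by positivity, fun x => ?_⟩
  have hKfin : ENNReal.ofReal K * ∫⁻ s, h s ≠ ⊤ := ENNReal.mul_ne_top ENNReal.ofReal_ne_top hfin
  calc ∫⁻ y, ‖Real.log (x - y)‖ₑ ∂(nu β c)
      ≤ ∫⁻ y, (ENNReal.ofReal |x - y| + h (x - y)) ∂(nu β c) := lintegral_mono fun y => hle _
    _ = ∫⁻ y, ENNReal.ofReal |x - y| ∂(nu β c) + ∫⁻ y, h (x - y) ∂(nu β c) :=
        lintegral_add_left (by fun_prop) _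
    _ ≤ ENNReal.ofReal (|x| + b β c) + ENNReal.ofReal K * ∫⁻ s, h s := by
        gcongr
        · calc ∫⁻ y, ENNReal.ofReal |x - y| ∂(nu β c)
              ≤ ∫⁻ y, ENNReal.ofReal (|x| + b β c) ∂(nu β c) := by
                refine lintegral_mono_ae ((ae_nu_abs_le β c).mono fun y hy => ?_)
                exact ENNReal.ofReal_le_ofReal ((abs_sub x y).trans (by linarith))
            _ = _ := by simp
        · rw [nu, lintegral_withDensity_eq_lintegral_mul _ (measurable_density β c).ennreal_ofReal
            (by fun_prop), ← lintegral_sub_left_eq_self h x, ← lintegral_const_mul _ (by fun_prop)]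
          refine lintegral_mono fun y => ?_
          simp only [Pi.mul_apply]
          gcongr
          exact density_le hβ c y
    _ = _ := by
        rw [← add_assoc, ENNReal.ofReal_add (by positivity) ENNReal.toReal_nonneg,
          ENNReal.ofReal_toReal hKfin]

theorem integrable_log_sub {β c : ℝ} (hβ : 0 < β) [IsProbabilityMeasure (nu β c)] (x : ℝ) :
    Integrable (fun y => Real.log (x - y)) (nu β c) := by
  obtain ⟨M, -, hM⟩ := exists_lintegral_log_sub_le (c := c) hβ
  exact ⟨(by fun_prop : Measurable fun y => Real.log (x - y)).aestronglyMeasurable,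
    (hM x).trans_lt ENNReal.ofReal_lt_top⟩

theorem integrable_log_sub_prod {β c : ℝ} (hβ : 0 < β) [IsProbabilityMeasure (nu β c)]
    (μ : Measure ℝ) [IsProbabilityMeasure μ] (hμ : Integrable (fun x => x) μ) :
    Integrable (fun p : ℝ × ℝ => Real.log (p.1 - p.2)) (μ.prod (nu β c)) := by
  obtain ⟨M, -, hM⟩ := exists_lintegral_log_sub_le (c := c) hβ
  refine ⟨(by fun_prop : Measurable fun p : ℝ × ℝ =>
    Real.log (p.1 - p.2)).aestronglyMeasurable, ?_⟩
  rw [HasFiniteIntegral, lintegral_prod _ (by fun_prop)]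
  calc _ ≤ ∫⁻ x, ENNReal.ofReal (|x| + M) ∂μ := lintegral_mono fun x => hM x
    _ < ⊤ := (hμ.abs.add (integrable_const M)).lintegral_lt_top

/-- As `ν_{β,c}` is even, `log |x - y|` may be replaced by the mean of `log |x - y|` and
`log |x + y|`. -/
theorem integral_log_sub_eq {β c : ℝ} (hβ : 0 < β) [IsProbabilityMeasure (nu β c)] (x : ℝ) :
    ∫ y, Real.log (x - y) ∂(nu β c)
      = 1 / 2 * ∫ y, density β c y * Real.log (x ^ 2 - y ^ 2) := by
  have hint : ∀ x, Integrable (fun y => density β c y * Real.log (x - y)) := by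
    intro x
    have h := integrable_log_sub (c := c) hβ x
    rw [nu, integrable_withDensity_iff (measurable_density β c).ennreal_ofReal
      (ae_of_all _ fun _ => ENNReal.ofReal_lt_top)] at h
    refine h.congr (ae_of_all _ fun y => ?_)
    simp only [ENNReal.toReal_ofReal (density_nonneg hβ c _), mul_comm]
  have hneg : ∀ y, density β c (-y) = density β c y := fun y => by
    rw [← density_abs, abs_neg, density_abs]
  have h1 : ∫ y, density β c y * Real.log (x - y) = ∫ y, density β c y * Real.log (x + y) := by
    rw [← integral_neg_eq_self (fun y => density β c y * Real.log (x + y))]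
    simp only [hneg, sub_eq_add_neg]
  have hint2 : Integrable (fun y => density β c y * Real.log (x + y)) := by
    refine (hint x).comp_neg.congr (ae_of_all _ fun y => ?_)
    simp only [hneg, sub_neg_eq_add]
  have h2 : ∫ y, density β c y * Real.log (x ^ 2 - y ^ 2)
      = (∫ y, density β c y * Real.log (x - y)) + ∫ y, density β c y * Real.log (x + y) := by
    rw [← integral_add (hint x) hint2]
    have hne : ∀ᵐ y : ℝ, y ∉ ({x, -x} : Set ℝ) :=
      measure_eq_zero_iff_ae_notMem.1 ((Set.toFinite {x, -x}).measure_zero _)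
    refine integral_congr_ae (hne.mono fun y hy => ?_)
    simp only [mem_insert_iff, mem_singleton_iff, not_or] at hy
    have e1 : x - y ≠ 0 := fun h => hy.1 (by linarith)
    have e2 : x + y ≠ 0 := fun h => hy.2 (by linarith)
    simp only
    rw [← mul_add, ← Real.log_mul e1 e2]
    ring_nf
  rw [integral_nu hβ, h2, ← h1]
  ring

/-- The logarithmic potential of `ν_{β,c}`, in terms of a solution `w` of
`x² = (p + q w) (p + q / w)` outside the open unit disc. -/
theorem integral_log_sub_nu (hq : 0 < q) (hqp : q ≤ p) {x : ℝ} {w : ℂ} (hw : 1 ≤ ‖w‖)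
    (hx : (p * q : ℂ) * (w + w⁻¹) = x ^ 2 - p ^ 2 - q ^ 2) :
    ∫ y, Real.log (x - y) ∂(nu (4 * q ^ 2) (p ^ 2 - q ^ 2))
      = 1 / 2 * (Real.log (p * q) + Real.log ‖w‖ + p / q * (w⁻¹).re
        + (1 - p ^ 2 / q ^ 2) * (Real.log ‖w + (q / p : ℝ)‖ - Real.log ‖w‖)) := by
  have := isProbabilityMeasure_nu hq hqp
  have hp : 0 < p := hq.trans_le hqp
  set ρ := q / p with hρdef
  have hρ : 0 < ρ := div_pos hq hp
  have hρ1 : ρ ≤ 1 := (div_le_one hp).2 hqp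
  have hw0 : w ≠ 0 := by
    rintro rfl
    simp at hw
    linarith
  have hw' : 1 ≤ ‖conj w‖ := by rwa [RCLike.norm_conj]
  set G : ℂ → ℝ := fun z => (Real.log (p * q) - Real.log ‖w‖) + Real.log ‖z - w‖
    + Real.log ‖z - conj w‖ with hG
  have hlog : ∀ z : ℂ, ‖z‖ = 1 → z ≠ w → z ≠ conj w →
      Real.log (x ^ 2 - (p ^ 2 + q ^ 2 + 2 * p * q * z.re)) = G z := by
    intro z hz h1 h2
    have hzz : z * conj z = 1 := by rw [Complex.mul_conj, normSq_eq_norm_sq, hz]; simp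
    have e1 : ((x ^ 2 - (p ^ 2 + q ^ 2 + 2 * p * q * z.re) : ℝ) : ℂ)
        = (p * q : ℝ) * w⁻¹ * ((z - w) * (conj z - w)) := by
      have e2 : (2 : ℂ) * z.re = z + conj z := by rw [Complex.add_conj]; push_cast; ring
      have e3 : (z - w) * (conj z - w) = w * (w + w⁻¹ - 2 * z.re) := by
        rw [e2]
        field_simp
        linear_combination hzz
      rw [e3, show ∀ X : ℂ, (p * q : ℝ) * w⁻¹ * (w * X) = (p * q : ℝ) * X from
        fun X => by field_simp]
      push_cast
      linear_combination -hx
    have e4 : ‖conj z - w‖ = ‖z - conj w‖ := by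
      rw [← RCLike.norm_conj]
      simp
    have e5 : |x ^ 2 - (p ^ 2 + q ^ 2 + 2 * p * q * z.re)|
        = p * q * ‖w‖⁻¹ * (‖z - w‖ * ‖z - conj w‖) := by
      rw [← Real.norm_eq_abs, ← norm_real, e1, norm_mul, norm_mul, norm_mul, norm_inv, e4,
        norm_real, Real.norm_of_nonneg (by positivity)]
    have n1 : ‖z - w‖ ≠ 0 := norm_ne_zero_iff.2 (sub_ne_zero.2 h1)
    have n2 : ‖z - conj w‖ ≠ 0 := norm_ne_zero_iff.2 (sub_ne_zero.2 h2)
    have n3 : ‖w‖ ≠ 0 := norm_ne_zero_iff.2 hw0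
    rw [← Real.log_abs, e5, Real.log_mul (by positivity) (by positivity),
      Real.log_mul (by positivity) (by positivity), Real.log_mul n1 n2, Real.log_inv]
    simp only [hG]
    ring
  have hae : ∀ᵐ t : ℝ, weight ρ (circleMap 0 1 t) *
      Real.log (x ^ 2 - (p ^ 2 + q ^ 2 + 2 * p * q * (circleMap 0 1 t).re))
        = weight ρ (circleMap 0 1 t) * G (circleMap 0 1 t) := by
    have hne : ∀ᵐ t : ℝ, circleMap 0 1 t ∉ ({w, conj w} : Set ℂ) :=
      measure_eq_zero_iff_ae_notMem.1
        (((Set.toFinite {w, conj w}).countable.preimage_circleMap 0 one_ne_zero).measure_zero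
          volume)
    refine hne.mono fun t ht => ?_
    simp only [mem_insert_iff, mem_singleton_iff, not_or] at ht
    rw [hlog _ (by simp) ht.1 ht.2]
  have hcw := continuousOn_weight hρ hρ1
  have i0 : CircleIntegrable (fun z => (Real.log (p * q) - Real.log ‖w‖) • weight ρ z) 0 1 :=
    (hcw.circleIntegrable zero_le_one).const_smul
  have i1 := circleIntegrable_mul_log_norm_sub hcw w
  have i2 := circleIntegrable_mul_log_norm_sub hcw (conj w)
  have i01 : CircleIntegrable (fun z => (Real.log (p * q) - Real.log ‖w‖) • weight ρ z
    + weight ρ z * Real.log ‖z - w‖) 0 1 := i0.add i1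
  have hsplit : (fun z => weight ρ z * G z) = fun z =>
      ((Real.log (p * q) - Real.log ‖w‖) • weight ρ z + weight ρ z * Real.log ‖z - w‖)
        + weight ρ z * Real.log ‖z - conj w‖ := by
    funext z
    simp only [hG, smul_eq_mul]
    ring
  have hGi : CircleIntegrable (fun z => weight ρ z * G z) 0 1 := by
    rw [hsplit]
    exact i01.add i2
  have hgi : CircleIntegrable (fun z => weight ρ z *
      Real.log (x ^ 2 - (p ^ 2 + q ^ 2 + 2 * p * q * z.re))) 0 1 := by
    refine IntervalIntegrable.congr_ae hGi ?_
    exact ae_restrict_of_ae (hae.mono fun t ht => ht.symm)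
  have havg : circleAverage (fun z => weight ρ z *
      Real.log (x ^ 2 - (p ^ 2 + q ^ 2 + 2 * p * q * z.re))) 0 1
      = circleAverage (fun z => weight ρ z * G z) 0 1 := by
    rw [circleAverage, circleAverage]
    congr 1
    exact intervalIntegral.integral_congr_ae (hae.mono fun t ht _ => ht)
  have hconj : ‖conj w + ρ‖ = ‖w + ρ‖ := by
    rw [← RCLike.norm_conj]
    simp
  have hconj2 : ((conj w)⁻¹).re = (w⁻¹).re := by rw [← map_inv₀, conj_re]
  rw [integral_log_sub_eq (by positivity),
    integral_density hq hqp (fun s => Real.log (x ^ 2 - s)) hgi, havg, hsplit,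
    circleAverage_fun_add i01 i2, circleAverage_fun_add i0 i1, circleAverage_fun_smul,
    circleAverage_weight hρ hρ1, circleAverage_weight_mul_log_norm_sub hρ hρ1 hw,
    circleAverage_weight_mul_log_norm_sub hρ hρ1 hw', hconj, hconj2, RCLike.norm_conj, hρdef]
  simp only [smul_eq_mul]
  field_simp
  ring

theorem integral_sq_nu (hq : 0 < q) (hqp : q ≤ p) :
    ∫ y, y ^ 2 ∂(nu (4 * q ^ 2) (p ^ 2 - q ^ 2)) = p ^ 2 := by
  have hp : 0 < p := hq.trans_le hqp
  have hρ : 0 < q / p := div_pos hq hp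
  have hρ1 : q / p ≤ 1 := (div_le_one hp).2 hqp
  have hcw := continuousOn_weight hρ hρ1
  have i0 : CircleIntegrable (fun z => (p ^ 2 + q ^ 2) • weight (q / p) z) 0 1 :=
    (hcw.circleIntegrable zero_le_one).const_smul
  have i1 : CircleIntegrable (fun z => (2 * p * q) • (weight (q / p) z * z.re)) 0 1 :=
    ((hcw.mul (by fun_prop)).circleIntegrable zero_le_one).const_smul
  have hsplit : (fun z : ℂ => weight (q / p) z * (p ^ 2 + q ^ 2 + 2 * p * q * z.re)) = fun z =>
      (p ^ 2 + q ^ 2) • weight (q / p) z + (2 * p * q) • (weight (q / p) z * z.re) := by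
    funext z
    simp only [smul_eq_mul]
    ring
  rw [integral_nu (by positivity),
    integral_density hq hqp (fun s => s) (by rw [hsplit]; exact i0.add i1),
    hsplit, circleAverage_fun_add i0 i1, circleAverage_fun_smul, circleAverage_fun_smul,
    circleAverage_weight hρ hρ1, circleAverage_weight_mul_re hρ hρ1]
  simp only [smul_eq_mul]
  field_simp
  ring

/-! ### The Euler-Lagrange conditions -/

/-- The value of `U + Q / β` on the support, for `β = 4 q²` and `c = p² - q²`. -/
noncomputable def equilibriumConst (p q : ℝ) : ℝ :=
  (p ^ 2 + q ^ 2) / (4 * q ^ 2) - Real.log (p * q) / 2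
    - (p ^ 2 - q ^ 2) / (2 * q ^ 2) * Real.log p

theorem eulerLagrange_eq (hq : 0 < q) (hqp : q ≤ p) {x : ℝ}
    (hx : x ∈ S (4 * q ^ 2) (p ^ 2 - q ^ 2)) :
    -(∫ y, Real.log (x - y) ∂(nu (4 * q ^ 2) (p ^ 2 - q ^ 2)))
      + 1 / (4 * q ^ 2) * (x ^ 2 - 2 * (p ^ 2 - q ^ 2) * Real.log x) = equilibriumConst p q := by
  have hp : 0 < p := hq.trans_le hqp
  rw [S, a_eq hq hqp, b_eq hq hqp] at hx
  have hx1 : (p - q) ^ 2 ≤ x ^ 2 := by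
    rcases hx with ⟨h1, h2⟩ | ⟨h1, h2⟩ <;> nlinarith
  have hx2 : x ^ 2 ≤ (p + q) ^ 2 := by
    rcases hx with ⟨h1, h2⟩ | ⟨h1, h2⟩ <;> nlinarith
  set y := (x ^ 2 - p ^ 2 - q ^ 2) / (2 * p * q) with hy
  have hy1 : -1 ≤ y := by
    rw [hy, le_div_iff₀ (by positivity)]
    nlinarith
  have hy2 : y ≤ 1 := by
    rw [hy, div_le_iff₀ (by positivity)]
    nlinarith
  set w := circleMap 0 1 (Real.arccos y) with hw
  have hwn : ‖w‖ = 1 := by simp [hw]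
  have hwre : w.re = y := by rw [hw, circleMap_re, Real.cos_arccos hy1 hy2]
  have hinv : w⁻¹ = conj w := Complex.inv_eq_conj hwn
  have heq : (p * q : ℂ) * (w + w⁻¹) = x ^ 2 - p ^ 2 - q ^ 2 := by
    rw [hinv, Complex.add_conj, hwre, hy]
    push_cast
    have : (p : ℂ) ≠ 0 := by exact_mod_cast hp.ne'
    have : (q : ℂ) ≠ 0 := by exact_mod_cast hq.ne'
    field_simp
  have hnorm : ‖w + (q / p : ℝ)‖ ^ 2 = x ^ 2 / p ^ 2 := by
    have h1 : w.re * w.re + w.im * w.im = 1 := by rw [← normSq_apply, normSq_eq_norm_sq, hwn]; simp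
    rw [Complex.sq_norm, normSq_apply]
    simp only [add_re, add_im, ofReal_re, ofReal_im, add_zero]
    have h2 : x ^ 2 = p ^ 2 + q ^ 2 + 2 * p * q * w.re := by
      rw [hwre, hy]
      field_simp
      ring
    rw [h2]
    field_simp
    linear_combination p ^ 2 * h1
  -- The factor `p² - q²` takes care of `x = 0`, which lies in the support only if `p = q`.
  have hlog : (p ^ 2 - q ^ 2) * Real.log ‖w + (q / p : ℝ)‖
      = (p ^ 2 - q ^ 2) * (Real.log x - Real.log p) := by
    rcases hqp.lt_or_eq with hlt | rfl
    · have hx0 : x ≠ 0 := by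
        rintro rfl
        nlinarith
      have h := congrArg Real.log hnorm
      rw [Real.log_pow, Real.log_div (by positivity) (by positivity), Real.log_pow,
        Real.log_pow] at h
      simp only [Nat.cast_ofNat] at h
      congr 1
      linarith
    · simp
  have hpot := integral_log_sub_nu hq hqp hwn.ge heq
  rw [hwn, Real.log_one, hinv, conj_re, hwre, hy] at hpot
  rw [hpot, equilibriumConst]
  have hlog2 : (1 - p ^ 2 / q ^ 2) * (Real.log ‖w + (q / p : ℝ)‖ - 0)
      = (1 - p ^ 2 / q ^ 2) * (Real.log x - Real.log p) := by
    have : 1 - p ^ 2 / q ^ 2 = -(p ^ 2 - q ^ 2) / q ^ 2 := by field_simp; ring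
    rw [this]
    field_simp
    linear_combination -hlog
  rw [hlog2]
  field_simp
  ring

/-- The excess of `U + Q / β` over its value on the support, in the coordinate `v` of
`x² = (p + q v) (p + q / v)`; its derivative is
`p² (v² - 1)² / (4 v² (p + q v) (p v + q))`. The case `q < 0` is the one needed for the gap between
the two intervals of the support, where `x² = (p - |q| v) (p - |q| / v)`. -/
theorem eulerLagrange_excess_nonneg {p q v : ℝ} (hp : 0 < p) (hq : q ≠ 0) (hv : 1 ≤ v)
    (hpv : 0 < p + q * v) (hpq : 0 < p + q) :
    0 ≤ p / (4 * q) * (v - v⁻¹) - Real.log v / 2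
      - (p ^ 2 - q ^ 2) / (4 * q ^ 2) * (Real.log (p + q * v) - Real.log (p + q * v⁻¹)) := by
  set f : ℝ → ℝ := fun v => p / (4 * q) * (v - v⁻¹) - Real.log v / 2
      - (p ^ 2 - q ^ 2) / (4 * q ^ 2) * (Real.log (p + q * v) - Real.log (p + q * v⁻¹)) with hf
  have hpos : ∀ s ∈ Icc 1 v, 0 < s ∧ 0 < p + q * s ∧ 0 < p + q * s⁻¹ ∧ 0 < p * s + q := by
    intro s hs
    have hs0 : 0 < s := one_pos.trans_le hs.1
    have h1 : 0 < p + q * s := by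
      rcases le_total 0 q with h | h
      · nlinarith
      · nlinarith [hs.2]
    have h2 : 0 < p * s + q := by nlinarith [hs.1]
    refine ⟨hs0, h1, ?_, h2⟩
    rw [show p + q * s⁻¹ = (p * s + q) / s by field_simp]
    positivity
  have hd : ∀ s ∈ Icc 1 v, HasDerivAt f
      (p ^ 2 * (s ^ 2 - 1) ^ 2 / (4 * s ^ 2 * ((p + q * s) * (p * s + q)))) s := by
    intro s hs
    obtain ⟨hs0, h1, h2, h3⟩ := hpos s hs
    have hinv := hasDerivAt_inv hs0.ne'
    have d1 := ((hasDerivAt_id s).sub hinv).const_mul (p / (4 * q))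
    have d2 := (Real.hasDerivAt_log hs0.ne').div_const 2
    have d3 := (((hasDerivAt_id s).const_mul q).const_add p).log h1.ne'
    have d4 := ((hinv.const_mul q).const_add p).log h2.ne'
    refine ((d1.sub d2).sub ((d3.sub d4).const_mul ((p ^ 2 - q ^ 2) / (4 * q ^ 2)))).congr_deriv ?_
    have e : p + q * s⁻¹ = (p * s + q) / s := by field_simp
    simp only [id]
    rw [e]
    have := h1.ne'
    have := h3.ne'
    field_simp
    ring
  have hmono : MonotoneOn f (Icc 1 v) := by
    refine monotoneOn_of_deriv_nonneg (convex_Icc 1 v)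
      (fun s hs => (hd s hs).continuousAt.continuousWithinAt)
      (fun s hs => (hd s (interior_subset hs)).differentiableAt.differentiableWithinAt) ?_
    intro s hs
    have hs := interior_subset hs
    obtain ⟨hs0, h1, h2, h3⟩ := hpos s hs
    rw [(hd s hs).deriv]
    positivity
  have h := hmono (left_mem_Icc.2 hv) (right_mem_Icc.2 hv) hv
  have h1 : f 1 = 0 := by simp [hf]
  rw [h1] at h
  exact h

theorem exists_one_le_add_inv {y : ℝ} (hy : 1 ≤ y) : ∃ v, 1 ≤ v ∧ v + v⁻¹ = 2 * y := by
  have h0 : 0 ≤ y ^ 2 - 1 := by nlinarith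
  have hs := Real.sq_sqrt h0
  have hs0 := Real.sqrt_nonneg (y ^ 2 - 1)
  refine ⟨y + √(y ^ 2 - 1), by linarith, ?_⟩
  have : 0 < y + √(y ^ 2 - 1) := by linarith
  field_simp
  linear_combination hs

/-- The inequality `U + Q / β ≥ C` at the points `x` whose coordinate `w = ε v` is real. -/
theorem eulerLagrange_le_aux (hq : 0 < q) (hqp : q ≤ p) {x v ε : ℝ} (hε : ε = 1 ∨ ε = -1)
    (hv : 1 ≤ v) (hx : x ^ 2 = (p + ε * q * v) * (p + ε * q * v⁻¹)) (hpv : 0 < p + ε * q * v)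
    (hpq : 0 < p + ε * q) :
    equilibriumConst p q ≤ -(∫ y, Real.log (x - y) ∂(nu (4 * q ^ 2) (p ^ 2 - q ^ 2)))
      + 1 / (4 * q ^ 2) * (x ^ 2 - 2 * (p ^ 2 - q ^ 2) * Real.log x) := by
  have hp : 0 < p := hq.trans_le hqp
  have hv0 : 0 < v := one_pos.trans_le hv
  have hε2 : ε * ε = 1 := by rcases hε with rfl | rfl <;> norm_num
  have hε0 : ε ≠ 0 := by rintro rfl; simp at hε2
  have hεi : ε⁻¹ = ε := by rcases hε with rfl | rfl <;> norm_num
  have hεa : |ε| = 1 := by rcases hε with rfl | rfl <;> norm_num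
  have h3 : 0 < p * v + ε * q := by nlinarith
  have h2 : 0 < p + ε * q * v⁻¹ := by
    rw [show p + ε * q * v⁻¹ = (p * v + ε * q) / v by field_simp]
    positivity
  have hnw : ‖((ε * v : ℝ) : ℂ)‖ = v := by
    rw [norm_real, Real.norm_eq_abs, abs_mul, hεa, one_mul, abs_of_pos hv0]
  have heq : (p * q : ℂ) * (((ε * v : ℝ) : ℂ) + ((ε * v : ℝ) : ℂ)⁻¹) = x ^ 2 - p ^ 2 - q ^ 2 := by
    have : p * q * (ε * v + (ε * v)⁻¹) = x ^ 2 - p ^ 2 - q ^ 2 := by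
      rw [hx, mul_inv, hεi]
      field_simp
      linear_combination (-v * q ^ 2) * hε2
    exact_mod_cast this
  have hpot := integral_log_sub_nu hq hqp (by rw [hnw]; exact hv) heq
  have hre : ((((ε * v : ℝ) : ℂ))⁻¹).re = ε * v⁻¹ := by
    rw [← ofReal_inv, ofReal_re, mul_inv, hεi]
  have hn2 : ‖((ε * v : ℝ) : ℂ) + (q / p : ℝ)‖ = (p + ε * q * v⁻¹) * v / p := by
    rw [← ofReal_add, norm_real, Real.norm_eq_abs,
      show ε * v + q / p = ε * ((p + ε * q * v⁻¹) * v / p) by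
        field_simp
        linear_combination (-q) * hε2,
      abs_mul, hεa, one_mul, abs_of_pos (by positivity)]
  rw [hnw, hre, hn2, Real.log_div (by positivity) hp.ne', Real.log_mul h2.ne' hv0.ne'] at hpot
  have hlogx : Real.log x = (Real.log (p + ε * q * v) + Real.log (p + ε * q * v⁻¹)) / 2 := by
    rw [← Real.log_mul hpv.ne' h2.ne', ← hx, Real.log_pow]
    push_cast
    ring
  have hf := eulerLagrange_excess_nonneg hp (mul_ne_zero hε0 hq.ne') hv hpv hpq
  have hεq : (ε * q) ^ 2 = q ^ 2 := by linear_combination q ^ 2 * hε2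
  have hdiv : p / (4 * (ε * q)) = ε * p / (4 * q) := by
    field_simp
    linear_combination -hε2
  rw [hεq, hdiv] at hf
  rw [← sub_nonneg, hpot, hlogx, hx, equilibriumConst]
  refine hf.trans_eq ?_
  generalize Real.log (p + ε * q * v) = A
  generalize Real.log (p + ε * q * v⁻¹) = B
  field_simp
  linear_combination (-2 * q ^ 2 * v) * hε2

theorem eulerLagrange_le (hq : 0 < q) (hqp : q ≤ p) {x : ℝ} (hx0 : x ≠ 0 ∨ p = q) :
    equilibriumConst p q ≤ -(∫ y, Real.log (x - y) ∂(nu (4 * q ^ 2) (p ^ 2 - q ^ 2)))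
      + 1 / (4 * q ^ 2) * (x ^ 2 - 2 * (p ^ 2 - q ^ 2) * Real.log x) := by
  have hp : 0 < p := hq.trans_le hqp
  by_cases hS : x ∈ S (4 * q ^ 2) (p ^ 2 - q ^ 2)
  · exact (eulerLagrange_eq hq hqp hS).ge
  rw [S, a_eq hq hqp, b_eq hq hqp] at hS
  have hcases : x ^ 2 < (p - q) ^ 2 ∨ (p + q) ^ 2 < x ^ 2 := by
    by_contra! h
    obtain ⟨h1, h2⟩ := h
    have h1 := abs_le_of_sq_le_sq' h2 (by linarith)
    rcases le_total 0 x with h | h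
    · exact hS (Or.inr ⟨by nlinarith, h1.2⟩)
    · exact hS (Or.inl ⟨h1.1, by nlinarith⟩)
  rcases hcases with h | h
  · have hlt : q < p := lt_of_le_of_ne hqp fun h' => by
      subst h'
      nlinarith [sq_nonneg x]
    have hx0 : x ≠ 0 := hx0.resolve_right hlt.ne'
    obtain ⟨v, hv, hvy⟩ := exists_one_le_add_inv (y := (p ^ 2 + q ^ 2 - x ^ 2) / (2 * p * q)) (by
      rw [le_div_iff₀ (by positivity)]
      nlinarith)
    have hx : x ^ 2 = (p + -1 * q * v) * (p + -1 * q * v⁻¹) := by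
      have hv0 : v ≠ 0 := by linarith
      have h2 : p * q * (v + v⁻¹) = p ^ 2 + q ^ 2 - x ^ 2 := by rw [hvy]; field_simp
      have h3 : v * v⁻¹ = 1 := mul_inv_cancel₀ hv0
      linear_combination h2 - q ^ 2 * h3
    have hvi : v⁻¹ ≤ 1 := inv_le_one_of_one_le₀ hv
    have h2 : 0 < p + -1 * q * v⁻¹ := by nlinarith
    have h1 : 0 < p + -1 * q * v := by
      have : 0 < x ^ 2 := by positivity
      rw [hx] at this
      exact (pos_iff_pos_of_mul_pos this).2 h2
    exact eulerLagrange_le_aux hq hqp (Or.inr rfl) hv hx h1 (by linarith)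
  · obtain ⟨v, hv, hvy⟩ := exists_one_le_add_inv (y := (x ^ 2 - p ^ 2 - q ^ 2) / (2 * p * q)) (by
      rw [le_div_iff₀ (by positivity)]
      nlinarith)
    have hx : x ^ 2 = (p + 1 * q * v) * (p + 1 * q * v⁻¹) := by
      have hv0 : v ≠ 0 := by linarith
      have h2 : p * q * (v + v⁻¹) = x ^ 2 - p ^ 2 - q ^ 2 := by rw [hvy]; field_simp
      have h3 : v * v⁻¹ = 1 := mul_inv_cancel₀ hv0
      linear_combination -h2 - q ^ 2 * h3
    exact eulerLagrange_le_aux hq hqp (Or.inl rfl) hv hx (by positivity) (by linarith)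

end LogGas

/-! ### Extended integrals and the energy functional -/

namespace LogGas

open Set Filter

theorem eintegral_eq_integral {α : Type*} [MeasurableSpace α] {μ : Measure α} {f : α → EReal}
    {g : α → ℝ} (hg : Integrable g μ) (h : ∀ᵐ x ∂μ, f x = (g x : EReal)) :
    eintegral μ f = ((∫ x, g x ∂μ : ℝ) : EReal) := by
  have h1 : ∫⁻ x, (f x).toENNReal ∂μ = ∫⁻ x, ENNReal.ofReal (g x) ∂μ :=
    lintegral_congr_ae (h.mono fun x hx => by
      simp only [hx, EReal.toENNReal_of_ne_top (EReal.coe_ne_top _), EReal.toReal_coe])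
  have h2 : ∫⁻ x, (-f x).toENNReal ∂μ = ∫⁻ x, ENNReal.ofReal (-g x) ∂μ :=
    lintegral_congr_ae (h.mono fun x hx => by
      simp only [hx, ← EReal.coe_neg, EReal.toENNReal_of_ne_top (EReal.coe_ne_top _),
        EReal.toReal_coe])
  have f1 : ∫⁻ x, ENNReal.ofReal (g x) ∂μ ≠ ⊤ := hg.lintegral_lt_top.ne
  have f2 : ∫⁻ x, ENNReal.ofReal (-g x) ∂μ ≠ ⊤ := hg.neg.lintegral_lt_top.ne
  rw [eintegral, h1, h2, integral_eq_lintegral_pos_part_sub_lintegral_neg_part hg, EReal.coe_sub,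
    EReal.coe_ennreal_toReal f1, EReal.coe_ennreal_toReal f2]

/-- If `f` is bounded below by an integrable function and its extended integral is not `⊤`, then `f`
is almost everywhere finite and integrable. -/
theorem integrable_of_eintegral_ne_top {α : Type*} [MeasurableSpace α] {μ : Measure α}
    {f : α → EReal} {g : α → ℝ} (hf : Measurable f) (hg : Measurable g)
    (hfg : ∀ x, f x = (g x : EReal) ∨ f x = ⊤) {k : α → ℝ} (hk : Integrable k μ)
    (hgk : ∀ x, -g x ≤ k x) (h : eintegral μ f ≠ ⊤) :
    Integrable g μ ∧ ∀ᵐ x ∂μ, f x = (g x : EReal) := by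
  have hneg : ∀ x, (-f x).toENNReal ≤ ENNReal.ofReal (k x) := by
    intro x
    rcases hfg x with hx | hx
    · rw [hx, ← EReal.coe_neg, EReal.toENNReal_of_ne_top (EReal.coe_ne_top _), EReal.toReal_coe]
      exact ENNReal.ofReal_le_ofReal (hgk x)
    · rw [hx]
      simp
  have f2 : ∫⁻ x, (-f x).toENNReal ∂μ ≠ ⊤ :=
    ((lintegral_mono hneg).trans_lt hk.lintegral_lt_top).ne
  have f1 : ∫⁻ x, (f x).toENNReal ∂μ ≠ ⊤ := by
    intro htop
    apply h
    rw [eintegral, htop, ← EReal.coe_ennreal_toReal f2, EReal.coe_ennreal_top]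
    exact EReal.top_sub_coe _
  have hae : ∀ᵐ x ∂μ, f x = (g x : EReal) := by
    filter_upwards [ae_lt_top (by fun_prop) f1] with x hx
    refine (hfg x).resolve_right fun h => ?_
    simp [h] at hx
  refine ⟨⟨hg.aestronglyMeasurable, ?_⟩, hae⟩
  calc ∫⁻ x, ‖g x‖ₑ ∂μ ≤ ∫⁻ x, ((f x).toENNReal + ENNReal.ofReal (k x)) ∂μ := by
        refine lintegral_mono_ae (hae.mono fun x hx => ?_)
        rw [hx, EReal.toENNReal_of_ne_top (EReal.coe_ne_top _), EReal.toReal_coe,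
          Real.enorm_eq_ofReal_abs]
        rcases le_total 0 (g x) with h0 | h0
        · rw [abs_of_nonneg h0]
          exact le_self_add
        · rw [abs_of_nonpos h0]
          exact (ENNReal.ofReal_le_ofReal (hgk x)).trans le_add_self
    _ = ∫⁻ x, (f x).toENNReal ∂μ + ∫⁻ x, ENNReal.ofReal (k x) ∂μ :=
        lintegral_add_left (by fun_prop) _
    _ < ⊤ := ENNReal.add_lt_top.2 ⟨f1.lt_top, hk.lintegral_lt_top⟩

theorem logInv_of_ne_zero {x : ℝ} (hx : x ≠ 0) : logInv x = ((-Real.log x : ℝ) : EReal) := by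
  rw [logInv, if_neg hx, one_div, Real.log_inv, Real.log_abs]

theorem logInv_zero : logInv 0 = ⊤ := if_pos rfl

theorem measurable_logInv : Measurable logInv := by
  refine Measurable.ite (measurableSet_singleton 0) measurable_const ?_
  exact measurable_coe_real_ereal.comp (by fun_prop)

theorem Q_eq_coe {c t : ℝ} (h : t ≠ 0 ∨ c = 0) :
    Q c t = ((t ^ 2 - 2 * c * Real.log t : ℝ) : EReal) := by
  rcases eq_or_ne t 0 with rfl | ht
  · have hc : c = 0 := h.resolve_left (by simp)
    simp [Q, hc]
  · rw [Q, logInv_of_ne_zero ht, ← EReal.coe_mul, ← EReal.coe_add]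
    congr 1
    ring

theorem Q_zero {c : ℝ} (hc : 0 < c) : Q c 0 = ⊤ := by
  rw [Q, logInv_zero, EReal.coe_mul_top_of_pos (by positivity), EReal.coe_add_top]

theorem measurable_Q {c : ℝ} (hc : 0 ≤ c) : Measurable (Q c) := by
  rcases hc.eq_or_lt with rfl | hc
  · have : Q 0 = fun t => ((t ^ 2 - 2 * 0 * Real.log t : ℝ) : EReal) :=
      funext fun t => Q_eq_coe (Or.inr rfl)
    rw [this]
    exact measurable_coe_real_ereal.comp (by fun_prop)
  · have : Q c = fun t => if t = 0 then ⊤ else ((t ^ 2 - 2 * c * Real.log t : ℝ) : EReal) := by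
      funext t
      split_ifs with h
      · rw [h, Q_zero hc]
      · exact Q_eq_coe (Or.inl h)
    rw [this]
    exact Measurable.ite (measurableSet_singleton 0) measurable_const
      (measurable_coe_real_ereal.comp (by fun_prop))

theorem Q_eq_coe_or_top {c : ℝ} (hc : 0 ≤ c) (t : ℝ) :
    Q c t = ((t ^ 2 - 2 * c * Real.log t : ℝ) : EReal) ∨ Q c t = ⊤ := by
  by_cases h : t ≠ 0 ∨ c = 0
  · exact Or.inl (Q_eq_coe h)
  · push Not at h
    rw [h.1]
    exact Or.inr (Q_zero (lt_of_le_of_ne hc (Ne.symm h.2)))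

theorem log_le_abs (x : ℝ) : Real.log x ≤ |x| := by
  rcases eq_or_ne x 0 with rfl | hx
  · simp
  · rw [← Real.log_abs]
    linarith [Real.log_le_sub_one_of_pos (abs_pos.2 hx)]

theorem sq_div_two_le {c : ℝ} (hc : 0 ≤ c) (t : ℝ) :
    t ^ 2 / 2 - 2 * c ^ 2 ≤ t ^ 2 - 2 * c * Real.log t := by
  have h := mul_le_mul_of_nonneg_left (log_le_abs t) hc
  nlinarith [sq_nonneg (|t| - 2 * c), sq_abs t]

theorem energy_eq_coe (β : ℝ) {c : ℝ} {μ : Measure ℝ}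
    (hQ : Integrable (fun t => t ^ 2 - 2 * c * Real.log t) μ)
    (hQ' : ∀ᵐ t ∂μ, Q c t = ((t ^ 2 - 2 * c * Real.log t : ℝ) : EReal))
    (hI : Integrable (fun p : ℝ × ℝ => Real.log (p.1 - p.2)) (μ.prod μ))
    (hd : ∀ᵐ p ∂(μ.prod μ), p.1 ≠ p.2) :
    energy β c μ = ((-(β / 2) * (∫ p, Real.log (p.1 - p.2) ∂(μ.prod μ))
      + ∫ t, (t ^ 2 - 2 * c * Real.log t) ∂μ : ℝ) : EReal) := by
  have h1 := eintegral_eq_integral hQ hQ'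
  have h2 : logEnergy μ = ((∫ p, -Real.log (p.1 - p.2) ∂(μ.prod μ) : ℝ) : EReal) :=
    eintegral_eq_integral hI.neg (hd.mono fun p hp => logInv_of_ne_zero (sub_ne_zero.2 hp))
  rw [energy, h1, if_neg (EReal.coe_ne_top _), h2, ← EReal.coe_mul, ← EReal.coe_add, integral_neg]
  congr 1
  ring

/-- A measure of finite energy has a finite second moment and a finite logarithmic energy. -/
theorem integrable_of_energy_ne_top {β c : ℝ} (hβ : 0 < β) (hc : 0 ≤ c) {μ : Measure ℝ}
    [IsProbabilityMeasure μ] (h : energy β c μ ≠ ⊤) :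
    Integrable (fun x => x) μ ∧
    Integrable (fun t => t ^ 2 - 2 * c * Real.log t) μ ∧
    (∀ᵐ t ∂μ, Q c t = ((t ^ 2 - 2 * c * Real.log t : ℝ) : EReal)) ∧
    Integrable (fun p : ℝ × ℝ => Real.log (p.1 - p.2)) (μ.prod μ) ∧
    ∀ᵐ p ∂(μ.prod μ), p.1 ≠ p.2 := by
  have hne : eintegral μ (Q c) ≠ ⊤ := by
    intro h'
    exact h (by rw [energy, if_pos h'])
  obtain ⟨hQ, hQ'⟩ := integrable_of_eintegral_ne_top (measurable_Q hc)
    (g := fun t => t ^ 2 - 2 * c * Real.log t) (by fun_prop) (Q_eq_coe_or_top hc)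
    (integrable_const (2 * c ^ 2))
    (fun t => by linarith [sq_div_two_le hc t, sq_nonneg t]) hne
  have hx : Integrable (fun x => x) μ := by
    refine Integrable.mono' (hQ.add (integrable_const (2 * c ^ 2 + 1 / 2)))
      measurable_id.aestronglyMeasurable (ae_of_all _ fun x => ?_)
    simp only [Pi.add_apply, Real.norm_eq_abs]
    nlinarith [sq_div_two_le hc x, sq_nonneg (|x| - 1), sq_abs x]
  have hle : logEnergy μ ≠ ⊤ := by
    intro h'
    apply h
    rw [energy, if_neg hne, h', EReal.coe_mul_top_of_pos (by positivity),
      eintegral_eq_integral hQ hQ', EReal.top_add_coe]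
  have hk : Integrable (fun p : ℝ × ℝ => |p.1| + |p.2|) (μ.prod μ) :=
    (hx.abs.comp_fst μ).add (hx.abs.comp_snd μ)
  obtain ⟨hI, hI'⟩ := integrable_of_eintegral_ne_top (μ := μ.prod μ)
    (f := fun p : ℝ × ℝ => logInv (p.1 - p.2)) (g := fun p => -Real.log (p.1 - p.2))
    (measurable_logInv.comp (by fun_prop)) (by fun_prop)
    (fun p => by
      rcases eq_or_ne (p.1 - p.2) 0 with h0 | h0
      · rw [h0]
        exact Or.inr logInv_zero
      · exact Or.inl (logInv_of_ne_zero h0)) hk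
    (fun p => by
      rw [neg_neg]
      exact (log_le_abs _).trans (abs_sub _ _)) hle
  refine ⟨hx, hQ, hQ', by simpa using hI.neg, hI'.mono fun p hp heq => ?_⟩
  rw [heq, sub_self, logInv_zero] at hp
  exact EReal.coe_ne_top _ hp.symm

theorem ae_prod_fst_ne_snd (μ ν : Measure ℝ) [SFinite μ] [SFinite ν] [NullSingletonClass ν] :
    ∀ᵐ p ∂(μ.prod ν), p.1 ≠ p.2 := by
  have hs : MeasurableSet {p : ℝ × ℝ | p.1 = p.2} :=
    measurableSet_eq_fun measurable_fst measurable_snd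
  have : μ.prod ν {p : ℝ × ℝ | p.1 = p.2} = 0 := by
    rw [Measure.measure_prod_null hs]
    refine ae_of_all _ fun x => ?_
    have : Prod.mk x ⁻¹' {p : ℝ × ℝ | p.1 = p.2} = {x} := by
      ext y
      simp [eq_comm]
    simp only [this]
    exact measure_singleton x
  exact measure_eq_zero_iff_ae_notMem.1 this

theorem logPotential_nu {β c : ℝ} (hβ : 0 < β) [IsProbabilityMeasure (nu β c)] (x : ℝ) :
    logPotential (nu β c) x = ((-∫ y, Real.log (x - y) ∂(nu β c) : ℝ) : EReal) := by
  rw [logPotential, eintegral_eq_integral (integrable_log_sub hβ x).neg, integral_neg']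
  have : ∀ᵐ y ∂(nu β c), y ∉ ({x} : Set ℝ) := measure_eq_zero_iff_ae_notMem.1 (measure_singleton x)
  refine this.mono fun y hy => logInv_of_ne_zero (sub_ne_zero.2 fun h => hy ?_)
  exact h.symm

theorem ae_nu_mem_S (β c : ℝ) : ∀ᵐ y ∂(nu β c), y ∈ S β c := by
  rw [nu, ae_withDensity_iff (measurable_density β c).ennreal_ofReal]
  refine ae_of_all _ fun y hy => ?_
  by_contra h
  simp [density, indicator_of_notMem h] at hy

/-! ### The equilibrium measure -/

variable {p q : ℝ}

theorem integrable_id_nu (β c : ℝ) [IsProbabilityMeasure (nu β c)] :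
    Integrable (fun x => x) (nu β c) :=
  Integrable.of_bound measurable_id.aestronglyMeasurable (b β c) (ae_nu_abs_le β c)

theorem integrable_sq_nu (β c : ℝ) [IsProbabilityMeasure (nu β c)] :
    Integrable (fun x => x ^ 2) (nu β c) := by
  refine Integrable.of_bound (by fun_prop) (b β c ^ 2) ((ae_nu_abs_le β c).mono fun y hy => ?_)
  rw [norm_pow, Real.norm_eq_abs]
  exact pow_le_pow_left₀ (abs_nonneg y) hy 2

theorem integrable_log_nu {β : ℝ} (hβ : 0 < β) (c : ℝ) [IsProbabilityMeasure (nu β c)] :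
    Integrable (fun x => Real.log x) (nu β c) := by
  simpa using integrable_log_sub (c := c) hβ 0

theorem integrable_potential_nu {β : ℝ} (hβ : 0 < β) (c : ℝ) [IsProbabilityMeasure (nu β c)] :
    Integrable (fun t => t ^ 2 - 2 * c * Real.log t) (nu β c) :=
  (integrable_sq_nu β c).sub ((integrable_log_nu hβ c).const_mul _)

theorem energy_nu_eq {β : ℝ} (hβ : 0 < β) (c : ℝ) [IsProbabilityMeasure (nu β c)] :
    energy β c (nu β c) = ((-(β / 2) * (∫ p, Real.log (p.1 - p.2) ∂((nu β c).prod (nu β c)))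
      + ∫ t, (t ^ 2 - 2 * c * Real.log t) ∂(nu β c) : ℝ) : EReal) := by
  refine energy_eq_coe β (integrable_potential_nu hβ c) ?_
    (integrable_log_sub_prod hβ _ (integrable_id_nu β c)) (ae_prod_fst_ne_snd _ _)
  have : ∀ᵐ y ∂(nu β c), y ∉ ({0} : Set ℝ) := measure_eq_zero_iff_ae_notMem.1 (measure_singleton 0)
  exact this.mono fun y hy => Q_eq_coe (Or.inl hy)

/-- The integral of the Euler-Lagrange equation with respect to `ν_{β,c}`. -/
theorem logEnergy_nu_eq (hq : 0 < q) (hqp : q ≤ p)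
    [IsProbabilityMeasure (nu (4 * q ^ 2) (p ^ 2 - q ^ 2))] :
    -(∫ z, Real.log (z.1 - z.2) ∂((nu (4 * q ^ 2) (p ^ 2 - q ^ 2)).prod
        (nu (4 * q ^ 2) (p ^ 2 - q ^ 2))))
      + 1 / (4 * q ^ 2) * ∫ t, (t ^ 2 - 2 * (p ^ 2 - q ^ 2) * Real.log t)
        ∂(nu (4 * q ^ 2) (p ^ 2 - q ^ 2)) = equilibriumConst p q := by
  set ν := nu (4 * q ^ 2) (p ^ 2 - q ^ 2) with hν
  have hβ : 0 < 4 * q ^ 2 := by positivity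
  have hI : Integrable (fun z : ℝ × ℝ => Real.log (z.1 - z.2)) (ν.prod ν) :=
    integrable_log_sub_prod hβ ν (integrable_id_nu _ _)
  have h1 : Integrable (fun x => -∫ y, Real.log (x - y) ∂ν) ν := hI.integral_prod_left.neg
  rw [integral_prod _ hI, ← integral_neg, ← integral_const_mul,
    ← integral_add h1 ((integrable_potential_nu hβ _).const_mul _)]
  calc _ = ∫ _, equilibriumConst p q ∂ν :=
        integral_congr_ae ((ae_nu_mem_S _ _).mono fun x hx => eulerLagrange_eq hq hqp hx)
    _ = _ := by simp

/-- The integral of the Euler-Lagrange inequality with respect to a measure of finite energy. -/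
theorem le_logEnergy_prod_nu (hq : 0 < q) (hqp : q ≤ p)
    [IsProbabilityMeasure (nu (4 * q ^ 2) (p ^ 2 - q ^ 2))] {μ : Measure ℝ} [IsProbabilityMeasure μ]
    (hx : Integrable (fun x => x) μ)
    (hQ : Integrable (fun t => t ^ 2 - 2 * (p ^ 2 - q ^ 2) * Real.log t) μ)
    (hQ' : ∀ᵐ t ∂μ, Q (p ^ 2 - q ^ 2) t
      = ((t ^ 2 - 2 * (p ^ 2 - q ^ 2) * Real.log t : ℝ) : EReal)) :
    equilibriumConst p q ≤
      -(∫ z, Real.log (z.1 - z.2) ∂(μ.prod (nu (4 * q ^ 2) (p ^ 2 - q ^ 2))))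
      + 1 / (4 * q ^ 2) * ∫ t, (t ^ 2 - 2 * (p ^ 2 - q ^ 2) * Real.log t) ∂μ := by
  have hβ : 0 < 4 * q ^ 2 := by positivity
  have hI := integrable_log_sub_prod (c := p ^ 2 - q ^ 2) hβ μ hx
  have h1 : Integrable (fun x => -∫ y, Real.log (x - y) ∂(nu (4 * q ^ 2) (p ^ 2 - q ^ 2))) μ :=
    hI.integral_prod_left.neg
  rw [integral_prod _ hI, ← integral_neg, ← integral_const_mul,
    ← integral_add h1 (hQ.const_mul _)]
  calc equilibriumConst p q = ∫ _, equilibriumConst p q ∂μ := by simp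
    _ ≤ _ := by
      refine integral_mono_ae (integrable_const _) (h1.add (hQ.const_mul _))
        (hQ'.mono fun x hx => eulerLagrange_le hq hqp ?_)
      by_contra! h
      have hlt : q < p := lt_of_le_of_ne hqp (Ne.symm h.2)
      rw [h.1, Q_zero (by nlinarith)] at hx
      exact EReal.coe_ne_top _ hx.symm

/-- The potential at `0`, which lies in the gap; it corresponds to `w = -p / q`. -/
theorem integral_log_nu (hq : 0 < q) (hqp : q < p) :
    ∫ y, Real.log y ∂(nu (4 * q ^ 2) (p ^ 2 - q ^ 2))
      = Real.log p - 1 / 2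
        + 1 / 2 * (1 - p ^ 2 / q ^ 2) * (Real.log (p ^ 2 - q ^ 2) - 2 * Real.log p) := by
  have hp : 0 < p := hq.trans hqp
  have hd : 0 < p ^ 2 - q ^ 2 := by nlinarith
  have hn : ‖((-(p / q) : ℝ) : ℂ)‖ = p / q := by
    rw [Complex.norm_real, norm_neg, Real.norm_of_nonneg (by positivity)]
  have h := integral_log_sub_nu hq hqp.le (x := 0) (w := ((-(p / q) : ℝ) : ℂ))
    (by rw [hn, one_le_div hq]; exact hqp.le) (by
      have : p * q * (-(p / q) + (-(p / q))⁻¹) = 0 ^ 2 - p ^ 2 - q ^ 2 := by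
        field_simp
        ring
      exact_mod_cast this)
  have hn2 : ‖((-(p / q) : ℝ) : ℂ) + (q / p : ℝ)‖ = (p ^ 2 - q ^ 2) / (p * q) := by
    rw [← Complex.ofReal_add, Complex.norm_real, Real.norm_eq_abs,
      show -(p / q) + q / p = -((p ^ 2 - q ^ 2) / (p * q)) by field_simp; ring, abs_neg,
      abs_of_pos (by positivity)]
  rw [hn, hn2, ← Complex.ofReal_inv, Complex.ofReal_re, Real.log_div hp.ne' hq.ne',
    Real.log_div hd.ne' (by positivity), Real.log_mul hp.ne' hq.ne'] at h
  simp only [zero_sub, Real.log_neg_eq_log] at h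
  rw [h]
  field_simp
  ring

theorem energy_nu_eq_Estar (hq : 0 < q) (hqp : q ≤ p) :
    energy (4 * q ^ 2) (p ^ 2 - q ^ 2) (nu (4 * q ^ 2) (p ^ 2 - q ^ 2))
      = (Estar (4 * q ^ 2) (p ^ 2 - q ^ 2) : EReal) := by
  have := isProbabilityMeasure_nu hq hqp
  have hβ : 0 < 4 * q ^ 2 := by positivity
  have hp : 0 < p := hq.trans_le hqp
  rw [energy_nu_eq hβ]
  congr 1
  have h1 := logEnergy_nu_eq hq hqp
  have h2 : ∫ t, (t ^ 2 - 2 * (p ^ 2 - q ^ 2) * Real.log t) ∂(nu (4 * q ^ 2) (p ^ 2 - q ^ 2))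
      = p ^ 2 - 2 * (p ^ 2 - q ^ 2) * ∫ t, Real.log t ∂(nu (4 * q ^ 2) (p ^ 2 - q ^ 2)) := by
    rw [integral_sub (integrable_sq_nu _ _) ((integrable_log_nu hβ _).const_mul _),
      integral_sq_nu hq hqp, integral_const_mul]
  have e1 : Real.log (4 / (4 * q ^ 2)) = -2 * Real.log q := by
    rw [show 4 / (4 * q ^ 2) = (q ^ 2)⁻¹ by field_simp, Real.log_inv, Real.log_pow]
    push_cast
    ring
  have e2 : Real.log (1 + 4 * (p ^ 2 - q ^ 2) / (4 * q ^ 2)) = 2 * Real.log p - 2 * Real.log q := by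
    rw [show 1 + 4 * (p ^ 2 - q ^ 2) / (4 * q ^ 2) = p ^ 2 / q ^ 2 by field_simp; ring,
      Real.log_div (by positivity) (by positivity), Real.log_pow, Real.log_pow]
    push_cast
    ring
  set I := ∫ z, Real.log (z.1 - z.2) ∂((nu (4 * q ^ 2) (p ^ 2 - q ^ 2)).prod
        (nu (4 * q ^ 2) (p ^ 2 - q ^ 2)))
  have h3 : I = 1 / (4 * q ^ 2) * (∫ t, (t ^ 2 - 2 * (p ^ 2 - q ^ 2) * Real.log t)
        ∂(nu (4 * q ^ 2) (p ^ 2 - q ^ 2))) - equilibriumConst p q := by linarith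
  rw [h3, h2, equilibriumConst, Estar, e1, e2, Real.log_mul hp.ne' hq.ne']
  rcases hqp.lt_or_eq with hlt | rfl
  · have hd : 0 < p ^ 2 - q ^ 2 := by nlinarith
    have e3 : Real.log (4 * (p ^ 2 - q ^ 2) / (4 * q ^ 2))
        = Real.log (p ^ 2 - q ^ 2) - 2 * Real.log q := by
      rw [mul_div_mul_left _ _ (by norm_num : (4 : ℝ) ≠ 0), Real.log_div hd.ne' (by positivity),
        Real.log_pow]
      push_cast
      ring
    rw [integral_log_nu hq hlt, e3]
    generalize Real.log (p ^ 2 - q ^ 2) = L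
    field_simp
    ring
  · simp only [sub_self]
    field_simp
    ring

/-- By the Euler-Lagrange conditions, the energy of a measure of finite energy exceeds that of
`ν_{β,c}` at least by `β / 2` times the logarithmic energy of the difference, which is nonnegative
and vanishes only for `ν_{β,c}` itself. -/
theorem energy_nu_le (hq : 0 < q) (hqp : q ≤ p) (μ : Measure ℝ) [IsProbabilityMeasure μ] :
    energy (4 * q ^ 2) (p ^ 2 - q ^ 2) (nu (4 * q ^ 2) (p ^ 2 - q ^ 2))
        ≤ energy (4 * q ^ 2) (p ^ 2 - q ^ 2) μ ∧
      (energy (4 * q ^ 2) (p ^ 2 - q ^ 2) μ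
          = energy (4 * q ^ 2) (p ^ 2 - q ^ 2) (nu (4 * q ^ 2) (p ^ 2 - q ^ 2)) →
        μ = nu (4 * q ^ 2) (p ^ 2 - q ^ 2)) := by
  have := isProbabilityMeasure_nu hq hqp
  have hβ : 0 < 4 * q ^ 2 := by positivity
  have hc : 0 ≤ p ^ 2 - q ^ 2 := by nlinarith
  rw [energy_nu_eq hβ]
  by_cases htop : energy (4 * q ^ 2) (p ^ 2 - q ^ 2) μ = ⊤
  · rw [htop]
    exact ⟨le_top, fun h => absurd h.symm (EReal.coe_ne_top _)⟩
  obtain ⟨hx, hQ, hQ', hI, hd⟩ := integrable_of_energy_ne_top hβ hc htop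
  rw [energy_eq_coe _ hQ hQ' hI hd, EReal.coe_le_coe_iff, EReal.coe_eq_coe_iff]
  have h1 := logEnergy_nu_eq hq hqp
  have h2 := le_logEnergy_prod_nu hq hqp hx hQ hQ'
  obtain ⟨h3, h4⟩ := logEnergy_sub hI (integrable_log_sub_prod hβ _ (integrable_id_nu _ _))
    (integrable_log_sub_prod (c := p ^ 2 - q ^ 2) hβ μ hx) hd (ae_prod_fst_ne_snd _ _)
    (ae_prod_fst_ne_snd _ _)
  set ν := nu (4 * q ^ 2) (p ^ 2 - q ^ 2)
  set A := ∫ z, Real.log (z.1 - z.2) ∂(μ.prod μ)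
  set B := ∫ z, Real.log (z.1 - z.2) ∂(ν.prod ν)
  set D := ∫ z, Real.log (z.1 - z.2) ∂(μ.prod ν)
  set X := ∫ t, (t ^ 2 - 2 * (p ^ 2 - q ^ 2) * Real.log t) ∂μ
  set Y := ∫ t, (t ^ 2 - 2 * (p ^ 2 - q ^ 2) * Real.log t) ∂ν
  have h5 : 4 * q ^ 2 * (B - D) + X - Y ≥ 0 := by
    have h6 : 0 ≤ 4 * q ^ 2 * ((-D + 1 / (4 * q ^ 2) * X) - (-B + 1 / (4 * q ^ 2) * Y)) :=
      mul_nonneg hβ.le (by linarith)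
    have h7 : 4 * q ^ 2 * ((-D + 1 / (4 * q ^ 2) * X) - (-B + 1 / (4 * q ^ 2) * Y))
        = 4 * q ^ 2 * (B - D) + X - Y := by
      field_simp
      ring
    linarith
  have h8 := mul_nonneg hβ.le (sub_nonneg.2 h3)
  refine ⟨by nlinarith, fun h => h4 ?_⟩
  have h9 : 4 * q ^ 2 * (2 * D - (A + B)) = 0 := le_antisymm (by nlinarith) h8
  rcases mul_eq_zero.1 h9 with h | h
  · exact absurd h hβ.ne'
  · linarith

end LogGas

theorem proposition4p2 (β c : ℝ) (hβ : 0 < β) (hc : 0 ≤ c) :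
    IsProbabilityMeasure (LogGas.nu β c) ∧
    LogGas.energy β c (LogGas.nu β c) =
      (⨅ μ : ProbabilityMeasure ℝ, LogGas.energy β c (μ : Measure ℝ)) ∧
    LogGas.energy β c (LogGas.nu β c) = ((LogGas.Estar β c : ℝ) : EReal) ∧
    (∀ μ : Measure ℝ, IsProbabilityMeasure μ →
      LogGas.energy β c μ = LogGas.energy β c (LogGas.nu β c) → μ = LogGas.nu β c) ∧
    ∃ C : ℝ,
      (∀ x ∈ LogGas.S β c,
        LogGas.logPotential (LogGas.nu β c) x + ((1 / β : ℝ) : EReal) * LogGas.Q c x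
          = (C : EReal)) ∧
      (∀ x ∉ LogGas.S β c,
        (C : EReal) ≤
          LogGas.logPotential (LogGas.nu β c) x + ((1 / β : ℝ) : EReal) * LogGas.Q c x) := by
  obtain ⟨p, q, hq, hqp, rfl, rfl⟩ : ∃ p q : ℝ,
      0 < q ∧ q ≤ p ∧ β = 4 * q ^ 2 ∧ c = p ^ 2 - q ^ 2 := by
    refine ⟨√(c + β / 4), √(β / 4), Real.sqrt_pos.2 (by positivity),
      Real.sqrt_le_sqrt (by linarith), ?_, ?_⟩
    · rw [Real.sq_sqrt (by positivity)]
      ring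
    · rw [Real.sq_sqrt (by positivity), Real.sq_sqrt (by positivity)]
      ring
  have hν := LogGas.isProbabilityMeasure_nu hq hqp
  refine ⟨hν, le_antisymm (le_iInf fun μ => (LogGas.energy_nu_le hq hqp μ).1)
    (iInf_le_of_le ⟨_, hν⟩ le_rfl), LogGas.energy_nu_eq_Estar hq hqp,
    fun μ _ => (LogGas.energy_nu_le hq hqp μ).2, LogGas.equilibriumConst p q, fun x hx => ?_,
    fun x _ => ?_⟩
  · have h0 : x ≠ 0 ∨ p ^ 2 - q ^ 2 = 0 := by
      by_contra! h
      rw [LogGas.S, LogGas.a_eq hq hqp, h.1] at hx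
      have hlt : q < p := lt_of_le_of_ne hqp fun h' => h.2 (by rw [h', sub_self])
      rcases hx with hx | hx
      · linarith [hx.2]
      · linarith [hx.1]
    rw [LogGas.logPotential_nu hβ, LogGas.Q_eq_coe h0, ← EReal.coe_mul, ← EReal.coe_add,
      LogGas.eulerLagrange_eq hq hqp hx]
  · rw [LogGas.logPotential_nu hβ]
    by_cases h0 : x ≠ 0 ∨ p = q
    · rw [LogGas.Q_eq_coe (h0.imp_right fun h => by rw [h, sub_self]), ← EReal.coe_mul,
        ← EReal.coe_add, EReal.coe_le_coe_iff]
      exact LogGas.eulerLagrange_le hq hqp h0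
    · push Not at h0
      have hlt : q < p := lt_of_le_of_ne hqp (Ne.symm h0.2)
      rw [h0.1, LogGas.Q_zero (by nlinarith), EReal.coe_mul_top_of_pos (by positivity),
        EReal.coe_add_top]
      exact le_top
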